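/- Let $M$ be a connected smooth ($C^\infty$, Hausdorff, second countable) finite-dimensional manifold. A Finsler metric on $M$ is a continuous function $F\colon TM\to\mathbb{R}$ that is smooth on the complement of the zero section, satisfies $F(tv)=tF(v)$ for all $t>0$, and is such that at every nonzero $v\in T_pM$ the Hessian of $\frac12 F^2|_{T_pM}$ is positive definite. Let $F$ be a Randers metric, i.e. a Finsler metric of the form $F(v)=\sqrt{\alpha_p(v,v)}+\beta_p(v)$ ($v\in T_pM$), where $\alpha$ is a smooth Riemannian metric and $\beta$ is a smooth 1-form on $M$, and suppose that $F$ is non-Riemannian, i.e. $F$ is not of the form $v\mapsto\sqrt{g_p(v,v)}$ for any smooth Riemannian metric $g$ on $M$. Let $\beta^\sharp$ be the dual vector field of $\beta$, defined by $\alpha_p(\beta^\sharp_p,w)=\beta_p(w)$ for all $w\in T_pM$. Then $(M,F)$ is a generalized Berwald space, i.e. there is a smooth linear connection $\nabla$ on $M$ whose parallel transports along smooth curves preserve $F$ (for every smooth curve $c\colon[0,1]\to M$ and every $\nabla$-parallel vector field $X$ along $c$ one has $F(X(1))=F(X(0))$), if and only if $\beta^\sharp$ has positive constant length with respect to $\alpha$,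 i.e. there is a constant $K>0$ such that $\sqrt{\alpha_p(\beta^\sharp_p,\beta^\sharp_p)}=K$ for all $p\in M$. -/

import Mathlib

open Bundle Set
open scoped Manifold ContDiff

noncomputable section

namespace Randers

variable {E : Type*} [NormedAddCommGroup E] [NormedSpace ℝ E]
  {M : Type*} [TopologicalSpace M] [ChartedSpace E M]

/-! ### Finsler metrics -/

/-- A Finsler metric on `M`: a continuous function `F : TM → ℝ` that is smooth on the complement of
the zero section, positively homogeneous of degree one, and such that on every tangent space the
Hessian of the energy `F ^ 2 / 2` is positive definite at every nonzero vector. The Hessian is taken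
on the model space `E`, to which `TangentSpace 𝓘(ℝ, E) p` is equal as a topological vector space. -/
structure IsFinslerMetric [IsManifold 𝓘(ℝ, E) ∞ M] (F : TangentBundle 𝓘(ℝ, E) M → ℝ) : Prop where
  continuous : Continuous F
  smooth : ContMDiffOn 𝓘(ℝ, E).tangent 𝓘(ℝ, ℝ) ∞ F {v | v.snd ≠ 0}
  homogeneous : ∀ (p : M) (v : TangentSpace 𝓘(ℝ, E) p) (t : ℝ), 0 < t →
    F ⟨p, t • v⟩ = t * F ⟨p, v⟩
  strongly_convex : ∀ (p : M) (v w : E), v ≠ 0 → w ≠ 0 →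
    0 < iteratedFDeriv ℝ 2 (fun y : E ↦ F ⟨p, y⟩ ^ 2 / 2) v ![w, w]

/-- Smooth Riemannian metrics on `M`. -/
abbrev RMetric (E : Type*) [NormedAddCommGroup E] [NormedSpace ℝ E]
    (M : Type*) [TopologicalSpace M] [ChartedSpace E M] [IsManifold 𝓘(ℝ, E) ∞ M] :=
  ContMDiffRiemannianMetric 𝓘(ℝ, E) ∞ E (TangentSpace 𝓘(ℝ, E) : M → Type _)

/-- The length of a tangent vector with respect to a Riemannian metric. -/
def length [IsManifold 𝓘(ℝ, E) ∞ M] (g : RMetric E M) (p : M) (v : TangentSpace 𝓘(ℝ, E) p) : ℝ :=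
  √(g.inner p v v)

/-- `F` is Riemannian: it is the length function of some smooth Riemannian metric. -/
def IsRiemannian [IsManifold 𝓘(ℝ, E) ∞ M] (F : TangentBundle 𝓘(ℝ, E) M → ℝ) : Prop :=
  ∃ g : RMetric E M, ∀ (p : M) (v : TangentSpace 𝓘(ℝ, E) p), F ⟨p, v⟩ = length g p v

/-- A smooth 1-form on `M`. -/
def IsSmoothOneForm [IsManifold 𝓘(ℝ, E) ∞ M] (β : Π p : M, TangentSpace 𝓘(ℝ, E) p →L[ℝ] ℝ) : Prop :=
  ContMDiff 𝓘(ℝ, E) (𝓘(ℝ, E).prod 𝓘(ℝ, E →L[ℝ] ℝ)) ∞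
    (fun p ↦ (TotalSpace.mk' (E →L[ℝ] ℝ) p (β p) :
      TotalSpace (E →L[ℝ] ℝ) fun p : M ↦ TangentSpace 𝓘(ℝ, E) p →L[ℝ] ℝ))

/-- `F` is a Randers metric with Riemannian part `α` and perturbating term `β`. -/
structure IsRandersMetric [IsManifold 𝓘(ℝ, E) ∞ M] (F : TangentBundle 𝓘(ℝ, E) M → ℝ)
    (α : RMetric E M) (β : Π p : M, TangentSpace 𝓘(ℝ, E) p →L[ℝ] ℝ) : Prop where
  finsler : IsFinslerMetric F
  smooth_form : IsSmoothOneForm β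
  eq_add : ∀ (p : M) (v : TangentSpace 𝓘(ℝ, E) p), F ⟨p, v⟩ = length α p v + β p v

/-! ### The dual vector field of a 1-form -/

theorem exists_dual [FiniteDimensional ℝ E] [IsManifold 𝓘(ℝ, E) ∞ M] (g : RMetric E M)
    (β : Π p : M, TangentSpace 𝓘(ℝ, E) p →L[ℝ] ℝ) (p : M) :
    ∃ b : TangentSpace 𝓘(ℝ, E) p, ∀ w, g.inner p b w = β p w := by
  have : FiniteDimensional ℝ (TangentSpace 𝓘(ℝ, E) p) := inferInstanceAs (FiniteDimensional ℝ E)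
  let B : TangentSpace 𝓘(ℝ, E) p →ₗ[ℝ] Module.Dual ℝ (TangentSpace 𝓘(ℝ, E) p) :=
    { toFun := fun v ↦ (g.inner p v).toLinearMap
      map_add' := fun v w ↦ by ext; simp
      map_smul' := fun t v ↦ by ext; simp }
  have hB : Function.Injective B := by
    refine (injective_iff_map_eq_zero B).2 fun v hv ↦ ?_
    by_contra hne
    have h1 : g.inner p v v = 0 := LinearMap.congr_fun hv v
    exact (g.pos p v hne).ne' h1
  obtain ⟨b, hb⟩ := (LinearMap.injective_iff_surjective_of_finrank_eq_finrank
    (Subspace.dual_finrank_eq (K := ℝ) (V := TangentSpace 𝓘(ℝ, E) p)).symm).1 hB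
    (β p).toLinearMap
  exact ⟨b, fun w ↦ LinearMap.congr_fun hb w⟩

/-- The dual vector field `β^♯` of the 1-form `β`: `g (β^♯, w) = β w` for all `w`. -/
def sharp [FiniteDimensional ℝ E] [IsManifold 𝓘(ℝ, E) ∞ M] (g : RMetric E M)
    (β : Π p : M, TangentSpace 𝓘(ℝ, E) p →L[ℝ] ℝ) (p : M) : TangentSpace 𝓘(ℝ, E) p :=
  (exists_dual g β p).choose

theorem inner_sharp [FiniteDimensional ℝ E] [IsManifold 𝓘(ℝ, E) ∞ M] (g : RMetric E M)
    (β : Π p : M, TangentSpace 𝓘(ℝ, E) p →L[ℝ] ℝ) (p : M) (w : TangentSpace 𝓘(ℝ, E) p) :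
    g.inner p (sharp g β p) w = β p w :=
  (exists_dual g β p).choose_spec w

/-! ### Linear connections and parallel transport -/

/-- Linear connections on `M`, as covariant derivatives on the tangent bundle. -/
abbrev LinearConnection (E : Type*) [NormedAddCommGroup E] [NormedSpace ℝ E]
    (M : Type*) [TopologicalSpace M] [ChartedSpace E M] [IsManifold 𝓘(ℝ, E) ∞ M] :=
  CovariantDerivative 𝓘(ℝ, E) E (TangentSpace 𝓘(ℝ, E) : M → Type _)

/-- The components `y(v)` of a tangent vector `v` in the coordinates given by the chart at `x₀`. -/
def coord [IsManifold 𝓘(ℝ, E) ∞ M] (x₀ p : M) (v : TangentSpace 𝓘(ℝ, E) p) : E :=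
  (trivializationAt E (TangentSpace 𝓘(ℝ, E)) x₀ ⟨p, v⟩).2

/-- The vector field whose components in the coordinates given by the chart at `x₀` are constantly
`y` (it is zero outside the domain of the chart). -/
def coordField [IsManifold 𝓘(ℝ, E) ∞ M] (x₀ : M) (y : E) : Π p : M, TangentSpace 𝓘(ℝ, E) p :=
  fun p ↦ (trivializationAt E (TangentSpace 𝓘(ℝ, E)) x₀).symm p y

/-- The velocity of a curve `c : [0, 1] → M`. -/
def velocity (c : ℝ → M) (t : ℝ) : TangentSpace 𝓘(ℝ, E) (c t) :=
  mfderivWithin 𝓘(ℝ, ℝ) 𝓘(ℝ, E) c (Icc 0 1) t (1 : ℝ)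

/-- The vector field `X` along `c : [0, 1] → M` is parallel with respect to `cov`: in the
coordinates given by any chart, `(X ^ k)' = - (c ^ i)' X ^ j Γ_{ij} ^ k ∘ c` holds wherever `c` is in
the domain of the chart. For a fixed `t` the right-hand side is the component vector of
`-∇_{c'(t)} Y`, where `Y` is the field with the constant components `X ^ j (t)`, since
`∇_{∂_i} ∂_j = Γ_{ij} ^ k ∂_k`. -/
def IsParallelAlong [IsManifold 𝓘(ℝ, E) ∞ M] (cov : LinearConnection E M) (c : ℝ → M)
    (X : Π t : ℝ, TangentSpace 𝓘(ℝ, E) (c t)) : Prop :=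
  ∀ x₀ : M, ∀ t ∈ Icc (0 : ℝ) 1, c t ∈ (chartAt E x₀).source →
    HasDerivWithinAt (fun s ↦ coord x₀ (c s) (X s))
      (-coord x₀ (c t) (cov (coordField x₀ (coord x₀ (c t) (X t))) (c t) (velocity c t)))
      (Icc 0 1) t

/-- The parallel transport along the smooth curve `c : [0, 1] → M` takes `v` to `w`. -/
def IsParallelTransport [IsManifold 𝓘(ℝ, E) ∞ M] (cov : LinearConnection E M) (c : ℝ → M)
    (v : TangentSpace 𝓘(ℝ, E) (c 0)) (w : TangentSpace 𝓘(ℝ, E) (c 1)) : Prop :=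
  ∃ X : Π t : ℝ, TangentSpace 𝓘(ℝ, E) (c t), IsParallelAlong cov c X ∧ X 0 = v ∧ X 1 = w

/-- `cov` is compatible to `F`: its parallel transports preserve the Finslerian length. -/
def IsCompatible [IsManifold 𝓘(ℝ, E) ∞ M] (cov : LinearConnection E M)
    (F : TangentBundle 𝓘(ℝ, E) M → ℝ) : Prop :=
  ∀ c : ℝ → M, ContMDiffOn 𝓘(ℝ, ℝ) 𝓘(ℝ, E) ∞ c (Icc 0 1) →
    ∀ (v : TangentSpace 𝓘(ℝ, E) (c 0)) (w : TangentSpace 𝓘(ℝ, E) (c 1)),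
      IsParallelTransport cov c v w → F ⟨c 1, w⟩ = F ⟨c 0, v⟩

/-- `(M, F)` is a generalized Berwald space: there is a smooth linear connection compatible
to `F`. -/
def IsGeneralizedBerwald [IsManifold 𝓘(ℝ, E) ∞ M] (F : TangentBundle 𝓘(ℝ, E) M → ℝ) : Prop :=
  ∃ cov : LinearConnection E M,
    CovariantDerivative.ContMDiffCovariantDerivative cov ∞ ∧ IsCompatible cov F

end Randers

end

noncomputable section

namespace Randers

open Filter Topology

/-! ### Locality and sums of derivatives. -/

section

variable {E : Type*} [NormedAddCommGroup E] [NormedSpace ℝ E]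
  {M : Type*} [TopologicalSpace M] [ChartedSpace E M]

/-! If parallel transports preserve `F`, then, since `-X` is parallel along with `X`, both `F(X)`
and `F(-X)` are preserved; their sum and difference show that the `α`-length and `β` are preserved
separately. Transporting `β^♯` from `p` to `q` and applying Cauchy–Schwarz at `q` gives `|β^♯_p| ≤
|β^♯_q|` (`length_sharp_le`). Nearby points are joined in both directions by chart segments along
which the linear parallel equation is solvable (`exists_mem_nhds_isParallelAlong`), so the length is
locally constant, hence constant. The constant zero would make `F` Riemannian.

Conversely, a connection with `∇α = 0` and `∇β = 0` preserves `F`. With an orthonormal frame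
containing `β^♯/K` one would declare the frame parallel. Gram–Schmidt is avoided by an overcomplete
family `w a` with an involution `τ` and `Y = ∑ α(w a, Y) w (τ a)`: the connection `∑ d(α(w a, Y)) ⊗
w (τ a)` is metric by the symmetry under `τ`, and `β` is parallel because each `β(w a)` is constant
(`isAdaptedFrame`). A partition of unity glues these local connections
(`exists_isMetricAndParallel`), as all conditions are affine in the connection. -/

theorem source_mem_nhds {E M : Type*} [TopologicalSpace E] [TopologicalSpace M]
    [ChartedSpace E M] {x₀ p : M} (hp : p ∈ (chartAt E x₀).source) :
    (chartAt E x₀).source ∈ 𝓝 p :=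
  (chartAt E x₀).open_source.mem_nhds hp

theorem mvfderiv_congr {F : Type*} [NormedAddCommGroup F] [NormedSpace ℝ F] {f g : M → F} {p : M}
    (h : f =ᶠ[𝓝 p] g) : mvfderiv 𝓘(ℝ, E) f p = mvfderiv 𝓘(ℝ, E) g p := by
  ext v
  have := h.mfderiv_eq (I := 𝓘(ℝ, E)) (I' := 𝓘(ℝ, F))
  simp only [mvfderiv, ContinuousLinearMap.comp_apply]
  rw [this]
  rfl

theorem mvfderiv_sum {κ : Type*} (s : Finset κ) {f : κ → M → ℝ} {p : M}
    (hf : ∀ a ∈ s, MDifferentiableAt 𝓘(ℝ, E) 𝓘(ℝ, ℝ) (f a) p) :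
    MDifferentiableAt 𝓘(ℝ, E) 𝓘(ℝ, ℝ) (fun q ↦ ∑ a ∈ s, f a q) p ∧
    mvfderiv 𝓘(ℝ, E) (fun q ↦ ∑ a ∈ s, f a q) p = ∑ a ∈ s, mvfderiv 𝓘(ℝ, E) (f a) p := by
  classical
  induction s using Finset.induction_on with
  | empty => simpa using ⟨mdifferentiableAt_const, mvfderiv_const (0 : ℝ)⟩
  | insert a s ha ih =>
    obtain ⟨h1, h2⟩ := ih fun b hb ↦ hf b (Finset.mem_insert_of_mem hb)
    have h3 := hf a (Finset.mem_insert_self a s)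
    simp only [Finset.sum_insert ha]
    exact ⟨h3.add h1, by rw [mvfderiv_fun_add h3 h1, h2]⟩

variable [IsManifold 𝓘(ℝ, E) ∞ M]

/-! ### Coordinates of tangent vectors -/

theorem coord_eq {x₀ p : M} (hp : p ∈ (chartAt E x₀).source) (v : TangentSpace 𝓘(ℝ, E) p) :
    coord x₀ p v =
      (trivializationAt E (TangentSpace 𝓘(ℝ, E)) x₀).continuousLinearMapAt ℝ p v :=
  (Trivialization.continuousLinearMapAt_apply_of_mem
    (e := trivializationAt E (TangentSpace 𝓘(ℝ, E)) x₀) (R := ℝ) hp v).symm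

theorem coordField_eq {x₀ p : M} (hp : p ∈ (chartAt E x₀).source) (y : E) :
    coordField x₀ y p = (trivializationAt E (TangentSpace 𝓘(ℝ, E)) x₀).symmL ℝ p y :=
  ((trivializationAt E (TangentSpace 𝓘(ℝ, E)) x₀).symmL_apply (R := ℝ) hp y).symm

theorem coord_coordField {x₀ p : M} (hp : p ∈ (chartAt E x₀).source) (y : E) :
    coord x₀ p (coordField x₀ y p) = y := by
  rw [coord_eq hp, coordField_eq hp]
  exact Trivialization.continuousLinearMapAt_symmL _ hp y

theorem coordField_coord {x₀ p : M} (hp : p ∈ (chartAt E x₀).source)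
    (v : TangentSpace 𝓘(ℝ, E) p) : coordField x₀ (coord x₀ p v) p = v := by
  rw [coord_eq hp, coordField_eq hp]
  exact Trivialization.symmL_continuousLinearMapAt _ hp v

theorem coord_injective {x₀ p : M} (hp : p ∈ (chartAt E x₀).source)
    {v w : TangentSpace 𝓘(ℝ, E) p} (h : coord x₀ p v = coord x₀ p w) : v = w := by
  rw [← coordField_coord hp v, h, coordField_coord hp w]

theorem coord_add {x₀ p : M} (hp : p ∈ (chartAt E x₀).source) (v w : TangentSpace 𝓘(ℝ, E) p) :
    coord x₀ p (v + w) = coord x₀ p v + coord x₀ p w := by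
  simp only [coord_eq hp, map_add]

theorem coord_neg {x₀ p : M} (hp : p ∈ (chartAt E x₀).source) (v : TangentSpace 𝓘(ℝ, E) p) :
    coord x₀ p (-v) = -coord x₀ p v := by
  simp only [coord_eq hp, map_neg]

theorem coord_smul {x₀ p : M} (hp : p ∈ (chartAt E x₀).source) (a : ℝ)
    (v : TangentSpace 𝓘(ℝ, E) p) : coord x₀ p (a • v) = a • coord x₀ p v := by
  simp only [coord_eq hp, map_smul]

theorem contMDiffAt_section_iff_coord {n : ℕ∞ω} {x₀ p : M} (hn : n ≤ ∞)
    (hp : p ∈ (chartAt E x₀).source) (σ : Π q : M, TangentSpace 𝓘(ℝ, E) q) :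
    ContMDiffAt 𝓘(ℝ, E) (𝓘(ℝ, E).prod 𝓘(ℝ, E)) n (fun q ↦ TotalSpace.mk' E q (σ q)) p ↔
      ContMDiffAt 𝓘(ℝ, E) 𝓘(ℝ, E) n (fun q ↦ coord x₀ q (σ q)) p := by
  have : ContMDiffVectorBundle n E (TangentSpace 𝓘(ℝ, E) : M → Type _) 𝓘(ℝ, E) :=
    ContMDiffVectorBundle.of_le hn
  exact (trivializationAt E (TangentSpace 𝓘(ℝ, E)) x₀).contMDiffAt_section_iff (s := σ) hp

theorem mdifferentiableAt_section_iff_coord {x₀ p : M}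
    (hp : p ∈ (chartAt E x₀).source) (σ : Π q : M, TangentSpace 𝓘(ℝ, E) q) :
    MDifferentiableAt 𝓘(ℝ, E) (𝓘(ℝ, E).prod 𝓘(ℝ, E)) (fun q ↦ TotalSpace.mk' E q (σ q)) p ↔
      MDifferentiableAt 𝓘(ℝ, E) 𝓘(ℝ, E) (fun q ↦ coord x₀ q (σ q)) p :=
  (trivializationAt E (TangentSpace 𝓘(ℝ, E)) x₀).mdifferentiableAt_section_iff 𝓘(ℝ, E) σ hp

theorem eventually_coord_coordField {x₀ p : M} (hp : p ∈ (chartAt E x₀).source) (y : E) :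
    (fun q ↦ coord x₀ q (coordField x₀ y q)) =ᶠ[𝓝 p] fun _ ↦ y := by
  filter_upwards [source_mem_nhds hp] with q hq using coord_coordField hq y

theorem contMDiffAt_coordField {x₀ p : M} (hp : p ∈ (chartAt E x₀).source) (y : E) :
    ContMDiffAt 𝓘(ℝ, E) (𝓘(ℝ, E).prod 𝓘(ℝ, E)) ∞
      (fun q ↦ TotalSpace.mk' E q (coordField x₀ y q)) p := by
  rw [contMDiffAt_section_iff_coord le_rfl hp]
  exact contMDiffAt_const.congr_of_eventuallyEq (eventually_coord_coordField hp y)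

theorem mdifferentiableAt_coordField {x₀ p : M} (hp : p ∈ (chartAt E x₀).source) (y : E) :
    MDifferentiableAt 𝓘(ℝ, E) (𝓘(ℝ, E).prod 𝓘(ℝ, E))
      (fun q ↦ TotalSpace.mk' E q (coordField x₀ y q)) p :=
  (contMDiffAt_coordField hp y).mdifferentiableAt (by simp)

/-- Near `p` the coordinate field is linear in its component vector, and `∇` depends only on germs.
Together with the scalar version this gives linearity of the Christoffel symbols in the field slot.
-/
theorem cov_coordField_add (cov : LinearConnection E M) {x₀ p : M}
    (hp : p ∈ (chartAt E x₀).source) (y z : E) :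
    cov (coordField x₀ (y + z)) p = cov (coordField x₀ y) p + cov (coordField x₀ z) p := by
  rw [← cov.isCovariantDerivativeOnUniv.add (mdifferentiableAt_coordField hp y)
    (mdifferentiableAt_coordField hp z)]
  refine cov.isCovariantDerivativeOnUniv.congr_of_eventuallyEq
    (mdifferentiableAt_coordField hp _) ?_ univ_mem ?_
  · exact mdifferentiableAt_add_section (mdifferentiableAt_coordField hp y)
      (mdifferentiableAt_coordField hp z)
  · filter_upwards [source_mem_nhds hp] with q hq
    simp only [coordField_eq hq, Pi.add_apply, map_add]

theorem cov_coordField_smul (cov : LinearConnection E M) {x₀ p : M}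
    (hp : p ∈ (chartAt E x₀).source) (a : ℝ) (y : E) :
    cov (coordField x₀ (a • y)) p = a • cov (coordField x₀ y) p := by
  rw [← cov.isCovariantDerivativeOnUniv.smul_const a (mdifferentiableAt_coordField hp y)]
  refine cov.isCovariantDerivativeOnUniv.congr_of_eventuallyEq
    (mdifferentiableAt_coordField hp _) ?_ univ_mem ?_
  · exact (mdifferentiableAt_coordField hp y).smul_const_section
  · filter_upwards [source_mem_nhds hp] with q hq
    simp only [coordField_eq hq, Pi.smul_apply, map_smul]

theorem cov_coordField_neg (cov : LinearConnection E M) {x₀ p : M}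
    (hp : p ∈ (chartAt E x₀).source) (y : E) :
    cov (coordField x₀ (-y)) p = -cov (coordField x₀ y) p := by
  simpa using cov_coordField_smul cov hp (-1) y

/-- The flat connection of the coordinates given by the chart at `x₀`. -/
def flatConnection (x₀ : M) (σ : Π p : M, TangentSpace 𝓘(ℝ, E) p) (p : M) :
    TangentSpace 𝓘(ℝ, E) p →L[ℝ] TangentSpace 𝓘(ℝ, E) p :=
  (trivializationAt E (TangentSpace 𝓘(ℝ, E)) x₀).symmL ℝ p ∘L
    mvfderiv 𝓘(ℝ, E) (fun q ↦ coord x₀ q (σ q)) p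

theorem flatConnection_apply {x₀ p : M} (hp : p ∈ (chartAt E x₀).source)
    (σ : Π p : M, TangentSpace 𝓘(ℝ, E) p) (v : TangentSpace 𝓘(ℝ, E) p) :
    coord x₀ p (flatConnection x₀ σ p v) = mvfderiv 𝓘(ℝ, E) (fun q ↦ coord x₀ q (σ q)) p v := by
  rw [coord_eq hp]
  exact Trivialization.continuousLinearMapAt_symmL _ hp _

theorem flatConnection_coordField {x₀ p : M} (hp : p ∈ (chartAt E x₀).source) (y : E) :
    flatConnection x₀ (coordField x₀ y) p = 0 := by
  rw [flatConnection, mvfderiv_congr (eventually_coord_coordField hp y), mvfderiv_const]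
  simp

theorem isCovariantDerivativeOn_flatConnection (x₀ : M) :
    IsCovariantDerivativeOn (I := 𝓘(ℝ, E)) E (flatConnection x₀) (chartAt E x₀).source where
  add {σ τ p} hσ hτ hp := by
    rw [mdifferentiableAt_section_iff_coord hp] at hσ hτ
    have h : (fun q ↦ coord x₀ q ((σ + τ) q)) =ᶠ[𝓝 p]
        (fun q ↦ coord x₀ q (σ q)) + fun q ↦ coord x₀ q (τ q) := by
      filter_upwards [source_mem_nhds hp] with q hq using coord_add hq _ _
    rw [flatConnection, mvfderiv_congr h, mvfderiv_add hσ hτ]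
    simp [flatConnection]
  leibniz {σ g p} hσ hg hp := by
    rw [mdifferentiableAt_section_iff_coord hp] at hσ
    have h : (fun q ↦ coord x₀ q ((g • σ) q)) =ᶠ[𝓝 p] g • fun q ↦ coord x₀ q (σ q) := by
      filter_upwards [source_mem_nhds hp] with q hq using coord_smul hq _ _
    rw [flatConnection, mvfderiv_congr h, mvfderiv_smul hg hσ]
    ext v
    have h' : (trivializationAt E (TangentSpace 𝓘(ℝ, E)) x₀).symmL ℝ p (coord x₀ p (σ p)) = σ p := by
      rw [← coordField_eq hp, coordField_coord hp]
    simp [flatConnection, h']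

/-- The coordinate expression of a covariant derivative: `(∇_v σ)^k = v(σ^k) + v^i σ^j Γ_{ij}^k`. -/
theorem coord_cov [FiniteDimensional ℝ E] (cov : LinearConnection E M) {x₀ p : M}
    (hp : p ∈ (chartAt E x₀).source) {σ : Π p : M, TangentSpace 𝓘(ℝ, E) p}
    (hσ : MDifferentiableAt 𝓘(ℝ, E) (𝓘(ℝ, E).prod 𝓘(ℝ, E))
      (fun q ↦ TotalSpace.mk' E q (σ q)) p) (v : TangentSpace 𝓘(ℝ, E) p) :
    coord x₀ p (cov σ p v) = mvfderiv 𝓘(ℝ, E) (fun q ↦ coord x₀ q (σ q)) p v +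
      coord x₀ p (cov (coordField x₀ (coord x₀ p (σ p))) p v) := by
  have hflat := isCovariantDerivativeOn_flatConnection (E := E) x₀
  have hcov := cov.isCovariantDerivativeOn (s := (chartAt E x₀).source)
  -- The difference from the flat connection is tensorial, so it can be evaluated on the coordinate
  -- field with the same value at `p`, which the flat connection kills.
  have h1 := hcov.difference_apply hflat hp hσ
  have h2 := hcov.difference_apply hflat hp
    (mdifferentiableAt_coordField hp (coord x₀ p (σ p)))
  rw [coordField_coord hp, h1, flatConnection_coordField hp, sub_zero] at h2
  rw [← flatConnection_apply hp, ← coord_add hp, ← h2]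
  simp

end

section

variable {E : Type*} [NormedAddCommGroup E] [NormedSpace ℝ E]
  {M : Type*} [TopologicalSpace M] [ChartedSpace E M]

/-! ### Derivatives along curves -/

theorem eventually_curve_mem_source {E M : Type*} [TopologicalSpace E] [TopologicalSpace M]
    [ChartedSpace E M] {c : ℝ → M} {t : ℝ} {x₀ : M}
    (hc : ContinuousWithinAt c (Icc 0 1) t) (h : c t ∈ (chartAt E x₀).source) :
    ∀ᶠ s in 𝓝[Icc 0 1] t, c s ∈ (chartAt E x₀).source :=
  hc (source_mem_nhds h)

theorem hasDerivWithinAt_comp_curve {F : Type*} [NormedAddCommGroup F] [NormedSpace ℝ F]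
    {f : M → F} {c : ℝ → M} {t : ℝ}
    (hf : MDifferentiableAt 𝓘(ℝ, E) 𝓘(ℝ, F) f (c t))
    (hc : MDifferentiableWithinAt 𝓘(ℝ, ℝ) 𝓘(ℝ, E) c (Icc 0 1) t) :
    HasDerivWithinAt (fun s ↦ f (c s)) (mvfderiv 𝓘(ℝ, E) f (c t) (velocity c t)) (Icc 0 1) t := by
  have h := hf.hasMFDerivAt.comp_hasMFDerivWithinAt t hc.hasMFDerivWithinAt
  have h' : HasFDerivWithinAt (fun s ↦ f (c s)) ((mvfderiv 𝓘(ℝ, E) f (c t)).comp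
      (mfderivWithin 𝓘(ℝ, ℝ) 𝓘(ℝ, E) c (Icc 0 1) t) : ℝ →L[ℝ] F) (Icc 0 1) t :=
    hasMFDerivWithinAt_iff_hasFDerivWithinAt.1 h
  exact h'.hasDerivWithinAt

variable [IsManifold 𝓘(ℝ, E) ∞ M]

/-- The coordinate expression of a 1-form in the chart at `x₀`. -/
def formCoord (β : Π p : M, TangentSpace 𝓘(ℝ, E) p →L[ℝ] ℝ) (x₀ p : M) : E →L[ℝ] ℝ :=
  ContinuousLinearMap.inCoordinates E (TangentSpace 𝓘(ℝ, E)) ℝ (Trivial M ℝ) x₀ p x₀ p (β p)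

theorem formCoord_apply (β : Π p : M, TangentSpace 𝓘(ℝ, E) p →L[ℝ] ℝ) {x₀ p : M}
    (hp : p ∈ (chartAt E x₀).source) (y : E) :
    formCoord β x₀ p y = β p (coordField x₀ y p) := by
  rw [coordField_eq hp]
  simp [formCoord, ContinuousLinearMap.inCoordinates]

/-- A 1-form is smooth at a point. -/
def IsSmoothOneFormAt (β : Π p : M, TangentSpace 𝓘(ℝ, E) p →L[ℝ] ℝ) (p : M) : Prop :=
  ContMDiffAt 𝓘(ℝ, E) (𝓘(ℝ, E).prod 𝓘(ℝ, E →L[ℝ] ℝ)) ∞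
    (fun p ↦ (TotalSpace.mk' (E →L[ℝ] ℝ) p (β p) :
      TotalSpace (E →L[ℝ] ℝ) fun p : M ↦ TangentSpace 𝓘(ℝ, E) p →L[ℝ] ℝ)) p

theorem isSmoothOneFormAt_iff {β : Π p : M, TangentSpace 𝓘(ℝ, E) p →L[ℝ] ℝ} {p : M} :
    IsSmoothOneFormAt β p ↔ ContMDiffAt 𝓘(ℝ, E) 𝓘(ℝ, E →L[ℝ] ℝ) ∞ (formCoord β p) p :=
  (contMDiffAt_hom_bundle _).trans (and_iff_right contMDiffAt_id)

/-- The coordinate expression of a Riemannian metric in the chart at `x₀`. -/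
def metricCoord (α : RMetric E M) (x₀ p : M) : E →L[ℝ] E →L[ℝ] ℝ :=
  ContinuousLinearMap.inCoordinates E (TangentSpace 𝓘(ℝ, E)) (E →L[ℝ] ℝ)
    (fun p : M ↦ TangentSpace 𝓘(ℝ, E) p →L[ℝ] ℝ) x₀ p x₀ p (α.inner p)

theorem metricCoord_apply (α : RMetric E M) {x₀ p : M} (hp : p ∈ (chartAt E x₀).source)
    (y z : E) :
    metricCoord α x₀ p y z = α.inner p (coordField x₀ y p) (coordField x₀ z p) := by
  rw [metricCoord, inCoordinates_apply_eq₂ (E₃ := Trivial M ℝ) hp hp (mem_univ _)]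
  simp [coordField]

theorem contMDiffAt_metricCoord (α : RMetric E M) (p : M) :
    ContMDiffAt 𝓘(ℝ, E) 𝓘(ℝ, E →L[ℝ] E →L[ℝ] ℝ) ∞ (metricCoord α p) p :=
  ((contMDiffAt_hom_bundle _).1 (α.contMDiff p)).2

/-- Product rule in the chart at `c t`. The first term freezes the components of `X`, so that `∇β =
0` can be applied to a coordinate field. -/
theorem hasDerivWithinAt_form_curve {β : Π p : M, TangentSpace 𝓘(ℝ, E) p →L[ℝ] ℝ}
    (hβ : IsSmoothOneForm β) {c : ℝ → M} {t : ℝ} (ht : t ∈ Icc (0 : ℝ) 1)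
    (hc : MDifferentiableWithinAt 𝓘(ℝ, ℝ) 𝓘(ℝ, E) c (Icc 0 1) t)
    {X : Π s : ℝ, TangentSpace 𝓘(ℝ, E) (c s)} {x' : E}
    (hX : HasDerivWithinAt (fun s ↦ coord (c t) (c s) (X s)) x' (Icc 0 1) t) :
    HasDerivWithinAt (fun s ↦ β (c s) (X s))
      (mvfderiv 𝓘(ℝ, E) (fun p ↦ β p (coordField (c t) (coord (c t) (c t) (X t)) p)) (c t)
        (velocity c t) + β (c t) (coordField (c t) x' (c t))) (Icc 0 1) t := by
  set p₀ := c t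
  have hp₀ : p₀ ∈ (chartAt E p₀).source := mem_chart_source E p₀
  set B : M → (E →L[ℝ] ℝ) := formCoord β p₀
  have hBapp : ∀ p ∈ (chartAt E p₀).source, ∀ y, B p y = β p (coordField p₀ y p) :=
    fun p hp y ↦ formCoord_apply β hp y
  have hB : MDifferentiableAt 𝓘(ℝ, E) 𝓘(ℝ, E →L[ℝ] ℝ) B p₀ :=
    (isSmoothOneFormAt_iff.1 (hβ p₀)).mdifferentiableAt (by simp)
  have h1 := (hasDerivWithinAt_comp_curve hB hc).clm_apply hX
  have hev := eventually_curve_mem_source hc.continuousWithinAt hp₀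
  have hu : UniqueDiffWithinAt ℝ (Icc (0 : ℝ) 1) t := uniqueDiffOn_Icc zero_lt_one t ht
  set y := coord p₀ p₀ (X t)
  have hev' : (fun p ↦ B p y) =ᶠ[𝓝 p₀] fun p ↦ β p (coordField p₀ y p) := by
    filter_upwards [source_mem_nhds hp₀] with p hp using hBapp p hp y
  -- Evaluation at a fixed `y` commutes with differentiation: both sides are the derivative at `t`
  -- of the same function along `c`.
  have h2 : mvfderiv 𝓘(ℝ, E) B p₀ (velocity c t) y = mvfderiv 𝓘(ℝ, E)
      (fun p ↦ β p (coordField p₀ y p)) p₀ (velocity c t) := by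
    rw [← mvfderiv_congr hev']
    have h3 := (hasDerivWithinAt_comp_curve hB hc).clm_apply (hasDerivWithinAt_const t _ y)
    have h4 : MDifferentiableAt 𝓘(ℝ, E) 𝓘(ℝ, ℝ) (fun p ↦ B p y) p₀ :=
      hB.clm_apply mdifferentiableAt_const
    have h5 := hu.eq_deriv _ h3 (hasDerivWithinAt_comp_curve h4 hc)
    simpa using h5
  rw [← h2, ← hBapp p₀ hp₀ x']
  refine h1.congr_of_eventuallyEq ?_ ?_
  · filter_upwards [hev] with s hs
    rw [hBapp _ hs, coordField_coord hs]
  · rw [hBapp _ hp₀, coordField_coord hp₀]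

/-- Again the product rule with frozen components; the two terms that differentiate `X` agree by
symmetry of `α`. -/
theorem hasDerivWithinAt_metric_curve (α : RMetric E M) {c : ℝ → M} {t : ℝ}
    (ht : t ∈ Icc (0 : ℝ) 1)
    (hc : MDifferentiableWithinAt 𝓘(ℝ, ℝ) 𝓘(ℝ, E) c (Icc 0 1) t)
    {X : Π s : ℝ, TangentSpace 𝓘(ℝ, E) (c s)} {x' : E}
    (hX : HasDerivWithinAt (fun s ↦ coord (c t) (c s) (X s)) x' (Icc 0 1) t) :
    HasDerivWithinAt (fun s ↦ α.inner (c s) (X s) (X s))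
      (mvfderiv 𝓘(ℝ, E) (fun p ↦ α.inner p (coordField (c t) (coord (c t) (c t) (X t)) p)
          (coordField (c t) (coord (c t) (c t) (X t)) p)) (c t) (velocity c t) +
        2 * α.inner (c t) (coordField (c t) x' (c t)) (X t)) (Icc 0 1) t := by
  set p₀ := c t
  have hp₀ : p₀ ∈ (chartAt E p₀).source := mem_chart_source E p₀
  set B : M → (E →L[ℝ] E →L[ℝ] ℝ) := metricCoord α p₀
  have hBapp : ∀ p ∈ (chartAt E p₀).source, ∀ y z,
      B p y z = α.inner p (coordField p₀ y p) (coordField p₀ z p) :=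
    fun p hp y z ↦ metricCoord_apply α hp y z
  have hB : MDifferentiableAt 𝓘(ℝ, E) 𝓘(ℝ, E →L[ℝ] E →L[ℝ] ℝ) B p₀ :=
    (contMDiffAt_metricCoord α p₀).mdifferentiableAt (by simp)
  have h1 := ((hasDerivWithinAt_comp_curve hB hc).clm_apply hX).clm_apply hX
  have hev := eventually_curve_mem_source hc.continuousWithinAt hp₀
  have hu : UniqueDiffWithinAt ℝ (Icc (0 : ℝ) 1) t := uniqueDiffOn_Icc zero_lt_one t ht
  have hy : coordField p₀ (coord p₀ p₀ (X t)) p₀ = X t := coordField_coord hp₀ _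
  set y := coord p₀ p₀ (X t)
  have hev' : (fun p ↦ B p y y) =ᶠ[𝓝 p₀]
      fun p ↦ α.inner p (coordField p₀ y p) (coordField p₀ y p) := by
    filter_upwards [source_mem_nhds hp₀] with p hp using hBapp p hp y y
  have h2 : mvfderiv 𝓘(ℝ, E) B p₀ (velocity c t) y y = mvfderiv 𝓘(ℝ, E)
      (fun p ↦ α.inner p (coordField p₀ y p) (coordField p₀ y p)) p₀ (velocity c t) := by
    rw [← mvfderiv_congr hev']
    have h3 := ((hasDerivWithinAt_comp_curve hB hc).clm_apply
      (hasDerivWithinAt_const t _ y)).clm_apply (hasDerivWithinAt_const t _ y)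
    have h4 : MDifferentiableAt 𝓘(ℝ, E) 𝓘(ℝ, ℝ) (fun p ↦ B p y y) p₀ :=
      (hB.clm_apply mdifferentiableAt_const).clm_apply mdifferentiableAt_const
    have h5 := hu.eq_deriv _ h3 (hasDerivWithinAt_comp_curve h4 hc)
    simpa using h5
  have h6 : B p₀ y x' = B p₀ x' y := by
    rw [hBapp p₀ hp₀, hBapp p₀ hp₀, α.symm]
  have h7 : B p₀ x' y = α.inner p₀ (coordField p₀ x' p₀) (X t) := by
    rw [hBapp p₀ hp₀, hy]
  refine (h1.congr_of_eventuallyEq (f₁ := fun s ↦ α.inner (c s) (X s) (X s)) ?_ ?_).congr_deriv ?_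
  · filter_upwards [hev] with s hs
    rw [hBapp _ hs, coordField_coord hs]
  · rw [hBapp _ hp₀, coordField_coord hp₀]
  · rw [← h2, ← h7]
    change (mvfderiv 𝓘(ℝ, E) B p₀ (velocity c t) y + B p₀ x') y + B p₀ y x' = _
    rw [h6, add_apply]
    ring

/-- A connection with `∇α = 0` and `∇β = 0`. -/
structure IsMetricAndParallel (cov : LinearConnection E M) (α : RMetric E M)
    (β : Π p : M, TangentSpace 𝓘(ℝ, E) p →L[ℝ] ℝ) : Prop where
  metric : ∀ (p : M) (Y : Π q : M, TangentSpace 𝓘(ℝ, E) q),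
    ContMDiffAt 𝓘(ℝ, E) (𝓘(ℝ, E).prod 𝓘(ℝ, E)) ∞ (fun q ↦ TotalSpace.mk' E q (Y q)) p →
    ∀ v, mvfderiv 𝓘(ℝ, E) (fun q ↦ α.inner q (Y q) (Y q)) p v = 2 * α.inner p (cov Y p v) (Y p)
  parallel : ∀ (p : M) (Y : Π q : M, TangentSpace 𝓘(ℝ, E) q),
    ContMDiffAt 𝓘(ℝ, E) (𝓘(ℝ, E).prod 𝓘(ℝ, E)) ∞ (fun q ↦ TotalSpace.mk' E q (Y q)) p →
    ∀ v, mvfderiv 𝓘(ℝ, E) (fun q ↦ β q (Y q)) p v = β p (cov Y p v)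

theorem eq_of_hasDerivWithinAt_zero {f : ℝ → ℝ}
    (h : ∀ t ∈ Icc (0 : ℝ) 1, HasDerivWithinAt f 0 (Icc 0 1) t) : f 1 = f 0 := by
  refine (convex_Icc (0 : ℝ) 1).is_const_of_fderivWithin_eq_zero (𝕜 := ℝ)
    (fun t ht ↦ (h t ht).differentiableWithinAt) (fun t ht ↦ ?_)
    (right_mem_Icc.2 zero_le_one) (left_mem_Icc.2 zero_le_one)
  rw [(h t ht).hasFDerivWithinAt.fderivWithin (uniqueDiffOn_Icc zero_lt_one t ht)]
  simp

/-- A connection with `∇α = 0` and `∇β = 0` is compatible to the Randers metric `α + β`. -/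
theorem IsMetricAndParallel.isCompatible {cov : LinearConnection E M} {α : RMetric E M}
    {β : Π p : M, TangentSpace 𝓘(ℝ, E) p →L[ℝ] ℝ} (h : IsMetricAndParallel cov α β)
    {F : TangentBundle 𝓘(ℝ, E) M → ℝ} (hF : IsRandersMetric F α β) : IsCompatible cov F := by
  rintro c hc _ _ ⟨X, hX, rfl, rfl⟩
  have hX' := fun t ht ↦ hX (c t) t ht (mem_chart_source E (c t))
  have hc' := fun t ht ↦ (hc t ht).mdifferentiableWithinAt (by simp : (∞ : ℕ∞ω) ≠ 0)
  have key : ∀ t, coordField (c t) (-coord (c t) (c t) (cov (coordField (c t)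
      (coord (c t) (c t) (X t))) (c t) (velocity c t))) (c t) =
      -cov (coordField (c t) (coord (c t) (c t) (X t))) (c t) (velocity c t) := by
    intro t
    rw [← coord_neg (mem_chart_source E (c t)), coordField_coord (mem_chart_source E (c t))]
  -- The parallel equation makes the moving term of the product rule cancel the frozen one, for `α`
  -- and likewise for `β`.
  have hα : α.inner (c 1) (X 1) (X 1) = α.inner (c 0) (X 0) (X 0) := by
    refine eq_of_hasDerivWithinAt_zero (f := fun t ↦ α.inner (c t) (X t) (X t)) fun t ht ↦ ?_
    refine (hasDerivWithinAt_metric_curve α ht (hc' t ht) (hX' t ht)).congr_deriv ?_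
    rw [h.metric _ _ (contMDiffAt_coordField (mem_chart_source E (c t)) _), key,
      coordField_coord (mem_chart_source E (c t))]
    simp
  have hβ : β (c 1) (X 1) = β (c 0) (X 0) := by
    refine eq_of_hasDerivWithinAt_zero (f := fun t ↦ β (c t) (X t)) fun t ht ↦ ?_
    refine (hasDerivWithinAt_form_curve hF.smooth_form ht (hc' t ht) (hX' t ht)).congr_deriv ?_
    rw [h.parallel _ _ (contMDiffAt_coordField (mem_chart_source E (c t)) _), key]
    simp
  rw [hF.eq_add, hF.eq_add, length, length, hα, hβ]

end

section

variable {E : Type*} [NormedAddCommGroup E] [NormedSpace ℝ E]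
  {M : Type*} [TopologicalSpace M] [ChartedSpace E M] [IsManifold 𝓘(ℝ, E) ∞ M]

/-! ### Smoothness of vector fields and forms -/

/-- A vector field is smooth at a point. -/
abbrev IsSmoothFieldAt (Y : Π q : M, TangentSpace 𝓘(ℝ, E) q) (p : M) : Prop :=
  ContMDiffAt 𝓘(ℝ, E) (𝓘(ℝ, E).prod 𝓘(ℝ, E)) ∞ (fun q ↦ TotalSpace.mk' E q (Y q)) p

/-- A vector field is differentiable at a point. -/
abbrev IsDifferentiableFieldAt (Y : Π q : M, TangentSpace 𝓘(ℝ, E) q) (p : M) : Prop :=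
  MDifferentiableAt 𝓘(ℝ, E) (𝓘(ℝ, E).prod 𝓘(ℝ, E)) (fun q ↦ TotalSpace.mk' E q (Y q)) p

theorem IsSmoothFieldAt.isDifferentiableFieldAt {Y : Π q : M, TangentSpace 𝓘(ℝ, E) q} {p : M}
    (hY : IsSmoothFieldAt Y p) : IsDifferentiableFieldAt Y p :=
  hY.mdifferentiableAt (by simp)

theorem contMDiffAt_inner (α : RMetric E M) {Y Z : Π q : M, TangentSpace 𝓘(ℝ, E) q} {p : M}
    (hY : IsSmoothFieldAt Y p) (hZ : IsSmoothFieldAt Z p) :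
    ContMDiffAt 𝓘(ℝ, E) 𝓘(ℝ, ℝ) ∞ (fun q ↦ α.inner q (Y q) (Z q)) p := by
  have : ContMDiffAt 𝓘(ℝ, E) (𝓘(ℝ, E).prod 𝓘(ℝ)) ∞
      (fun q ↦ TotalSpace.mk' ℝ (E := Bundle.Trivial M ℝ) q (α.inner q (Y q) (Z q))) p :=
    ContMDiffAt.clm_bundle_apply₂ (F₁ := E) (F₂ := E) (α.contMDiff p) hY hZ
  rw [contMDiffAt_totalSpace] at this
  exact this.2

theorem mdifferentiableAt_inner (α : RMetric E M) {Y Z : Π q : M, TangentSpace 𝓘(ℝ, E) q} {p : M}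
    (hY : IsDifferentiableFieldAt Y p) (hZ : IsDifferentiableFieldAt Z p) :
    MDifferentiableAt 𝓘(ℝ, E) 𝓘(ℝ, ℝ) (fun q ↦ α.inner q (Y q) (Z q)) p := by
  have : MDifferentiableAt 𝓘(ℝ, E) (𝓘(ℝ, E).prod 𝓘(ℝ))
      (fun q ↦ TotalSpace.mk' ℝ (E := Bundle.Trivial M ℝ) q (α.inner q (Y q) (Z q))) p :=
    MDifferentiableAt.clm_bundle_apply₂ (F₁ := E) (F₂ := E)
      ((α.contMDiff p).mdifferentiableAt (by simp)) hY hZ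
  rw [mdifferentiableAt_totalSpace] at this
  exact this.2

theorem IsSmoothOneFormAt.contMDiffAt_apply {β : Π p : M, TangentSpace 𝓘(ℝ, E) p →L[ℝ] ℝ} {p : M}
    (hβ : IsSmoothOneFormAt β p) {Y : Π q : M, TangentSpace 𝓘(ℝ, E) q}
    (hY : IsSmoothFieldAt Y p) : ContMDiffAt 𝓘(ℝ, E) 𝓘(ℝ, ℝ) ∞ (fun q ↦ β q (Y q)) p := by
  have : ContMDiffAt 𝓘(ℝ, E) (𝓘(ℝ, E).prod 𝓘(ℝ)) ∞
      (fun q ↦ TotalSpace.mk' ℝ (E := Bundle.Trivial M ℝ) q (β q (Y q))) p :=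
    ContMDiffAt.clm_bundle_apply (F₁ := E) (F₂ := ℝ) hβ hY
  rw [contMDiffAt_totalSpace] at this
  exact this.2

theorem isInvertible_metricCoord [FiniteDimensional ℝ E] (α : RMetric E M) {x₀ p : M}
    (hp : p ∈ (chartAt E x₀).source) : (metricCoord α x₀ p).IsInvertible := by
  have hinj : Function.Injective ((metricCoord α x₀ p : E →L[ℝ] E →L[ℝ] ℝ) : E →ₗ[ℝ] E →L[ℝ] ℝ) := by
    refine (injective_iff_map_eq_zero _).2 fun y hy ↦ ?_
    have h1 : metricCoord α x₀ p y y = 0 := by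
      have := congrArg (fun f : E →L[ℝ] ℝ ↦ f y) hy
      simpa using this
    rw [metricCoord_apply α hp] at h1
    by_contra hne
    refine (α.pos p (coordField x₀ y p) fun h0 ↦ hne ?_).ne' h1
    rw [← coord_coordField hp y, h0, coord_eq hp, map_zero]
  have hdim : Module.finrank ℝ E = Module.finrank ℝ (E →L[ℝ] ℝ) := by
    rw [← (LinearMap.toContinuousLinearMap (𝕜 := ℝ) (E := E) (F' := ℝ)).finrank_eq]
    exact (Subspace.dual_finrank_eq (K := ℝ) (V := E)).symm
  refine ⟨(LinearEquiv.ofInjectiveOfFinrankEq _ hinj hdim).toContinuousLinearEquiv, ?_⟩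
  ext; rfl

/-- `sharp` is chosen pointwise; in a chart it is the inverse of the metric matrix applied to the
components of `β`, and inversion is smooth at invertible maps. -/
theorem isSmoothFieldAt_sharp [FiniteDimensional ℝ E] (α : RMetric E M)
    {β : Π p : M, TangentSpace 𝓘(ℝ, E) p →L[ℝ] ℝ} {p : M} (hβ : IsSmoothOneFormAt β p) :
    IsSmoothFieldAt (sharp α β) p := by
  have hp := mem_chart_source E p
  rw [IsSmoothFieldAt, contMDiffAt_section_iff_coord le_rfl hp]
  have h1 : ContMDiffAt 𝓘(ℝ, E) 𝓘(ℝ, (E →L[ℝ] ℝ) →L[ℝ] E) ∞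
      (fun q ↦ (metricCoord α p q).inverse) p :=
    (isInvertible_metricCoord α hp).contDiffAt_map_inverse.contMDiffAt.comp p
      (contMDiffAt_metricCoord α p)
  refine (h1.clm_apply (isSmoothOneFormAt_iff.1 hβ)).congr_of_eventuallyEq ?_
  filter_upwards [source_mem_nhds hp] with q hq
  rw [eq_comm, (isInvertible_metricCoord α hq).inverse_apply_eq]
  ext z
  rw [metricCoord_apply α hq, formCoord_apply β hq, coordField_coord hq, inner_sharp]

/-- Smoothness of a single summand `df ⊗ Y` of `frameConnection`. -/
theorem contMDiffAt_mvfderiv_smulRight {f : M → ℝ} {p : M}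
    (hf : ContMDiffAt 𝓘(ℝ, E) 𝓘(ℝ, ℝ) ∞ f p) {Y : Π q : M, TangentSpace 𝓘(ℝ, E) q}
    (hY : IsSmoothFieldAt Y p) :
    ContMDiffAt 𝓘(ℝ, E) (𝓘(ℝ, E).prod 𝓘(ℝ, E →L[ℝ] E)) ∞
      (fun q ↦ (TotalSpace.mk' (E →L[ℝ] E) q ((mvfderiv 𝓘(ℝ, E) f q).smulRight (Y q)) :
        TotalSpace (E →L[ℝ] E) fun q : M ↦
          TangentSpace 𝓘(ℝ, E) q →L[ℝ] TangentSpace 𝓘(ℝ, E) q)) p := by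
  have hp := mem_chart_source E p
  refine (contMDiffAt_hom_bundle _).2 ⟨contMDiffAt_id, ?_⟩
  have h1 := hf.mfderiv_const (m := ∞) le_rfl
  rw [IsSmoothFieldAt, contMDiffAt_section_iff_coord le_rfl hp] at hY
  have hL : ContMDiff 𝓘(ℝ, E) 𝓘(ℝ, (E →L[ℝ] ℝ) →L[ℝ] (E →L[ℝ] E)) ∞
      (fun y : E ↦ (ContinuousLinearMap.smulRightL ℝ E E).flip y) :=
    (ContinuousLinearMap.contMDiff _)
  refine (((hL _).comp p hY).clm_apply h1).congr_of_eventuallyEq ?_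
  filter_upwards [source_mem_nhds hp] with q hq
  ext y
  simp [inTangentCoordinates, ContinuousLinearMap.inCoordinates, coord_eq hq]
  rfl

end

section

variable {E : Type*} [NormedAddCommGroup E] [NormedSpace ℝ E]
  {M : Type*} [TopologicalSpace M] [ChartedSpace E M] [IsManifold 𝓘(ℝ, E) ∞ M]

/-! ### The connection of an adapted frame -/

/-- A finite family of vector fields `w a`, smooth at the points of the open set `U`, with an
involution `τ` of the index set such that `Y = ∑ α (w a, Y) w (τ a)` for all `Y`, and such that the
functions `β (w a)` are constant on `U`. -/
structure IsAdaptedFrame {ι : Type*} [Fintype ι] (α : RMetric E M)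
    (β : Π p : M, TangentSpace 𝓘(ℝ, E) p →L[ℝ] ℝ) (w : ι → Π p : M, TangentSpace 𝓘(ℝ, E) p)
    (τ : Equiv.Perm ι) (U : Set M) : Prop where
  isOpen : IsOpen U
  involutive : ∀ a, τ (τ a) = a
  smooth : ∀ a, ∀ p ∈ U, IsSmoothFieldAt (w a) p
  sum_eq : ∀ p ∈ U, ∀ y : TangentSpace 𝓘(ℝ, E) p, ∑ a, α.inner p (w a p) y • w (τ a) p = y
  const : ∀ a, ∃ k : ℝ, ∀ p ∈ U, β p (w a p) = k

/-- The connection `∇ Y = ∑ d(α (w a, Y)) ⊗ w (τ a)`. -/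
def frameConnection {ι : Type*} [Fintype ι] (α : RMetric E M)
    (w : ι → Π p : M, TangentSpace 𝓘(ℝ, E) p) (τ : Equiv.Perm ι)
    (Y : Π p : M, TangentSpace 𝓘(ℝ, E) p) (p : M) :
    TangentSpace 𝓘(ℝ, E) p →L[ℝ] TangentSpace 𝓘(ℝ, E) p :=
  ∑ a, (mvfderiv 𝓘(ℝ, E) (fun q ↦ α.inner q (w a q) (Y q)) p).smulRight (w (τ a) p)

namespace IsAdaptedFrame

variable {ι : Type*} [Fintype ι] {α : RMetric E M}
  {β : Π p : M, TangentSpace 𝓘(ℝ, E) p →L[ℝ] ℝ} {w : ι → Π p : M, TangentSpace 𝓘(ℝ, E) p}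
  {τ : Equiv.Perm ι} {U : Set M}

/-- The extra term in the Leibniz rule is `dg ⊗ ∑ α(w a, Y) w (τ a)`, which is `dg ⊗ Y` by the frame
expansion. -/
theorem isCovariantDerivativeOn (h : IsAdaptedFrame α β w τ U) :
    IsCovariantDerivativeOn (I := 𝓘(ℝ, E)) E (frameConnection α w τ) U where
  add {Y Z p} hY hZ hp := by
    rw [frameConnection, frameConnection, frameConnection, ← Finset.sum_add_distrib]
    refine Finset.sum_congr rfl fun a _ ↦ ?_
    have hw := (h.smooth a p hp).isDifferentiableFieldAt
    have : (fun q ↦ α.inner q (w a q) ((Y + Z) q)) =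
        (fun q ↦ α.inner q (w a q) (Y q)) + fun q ↦ α.inner q (w a q) (Z q) := by
      ext q; simp
    rw [this, mvfderiv_add (mdifferentiableAt_inner α hw hY) (mdifferentiableAt_inner α hw hZ)]
    ext v
    simp [add_smul]
  leibniz {Y g p} hY hg hp := by
    ext v
    have hsum := h.sum_eq p hp (Y p)
    have key : ∀ a, mvfderiv 𝓘(ℝ, E) (fun q ↦ α.inner q (w a q) ((g • Y) q)) p v =
        g p * mvfderiv 𝓘(ℝ, E) (fun q ↦ α.inner q (w a q) (Y q)) p v +
          α.inner p (w a p) (Y p) * mvfderiv 𝓘(ℝ, E) g p v := by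
      intro a
      have hw := (h.smooth a p hp).isDifferentiableFieldAt
      have : (fun q ↦ α.inner q (w a q) ((g • Y) q)) =
          g * fun q ↦ α.inner q (w a q) (Y q) := by
        ext q; simp
      rw [this, mvfderiv_mul hg (mdifferentiableAt_inner α hw hY)]
      simp
    simp only [frameConnection, sum_apply, ContinuousLinearMap.smulRight_apply,
      add_apply, smul_apply, key, add_smul,
      Finset.sum_add_distrib, mul_smul, Finset.smul_sum]
    congr 1
    rw [← hsum, Finset.smul_sum]
    refine Finset.sum_congr rfl fun a _ ↦ ?_
    rw [smul_comm, hsum]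

theorem contMDiffAt_frameConnection (h : IsAdaptedFrame α β w τ U)
    {Y : Π p : M, TangentSpace 𝓘(ℝ, E) p} {p : M} (hp : p ∈ U) (hY : IsSmoothFieldAt Y p) :
    ContMDiffAt 𝓘(ℝ, E) (𝓘(ℝ, E).prod 𝓘(ℝ, E →L[ℝ] E)) ∞
      (fun q ↦ (TotalSpace.mk' (E →L[ℝ] E) q (frameConnection α w τ Y q) :
        TotalSpace (E →L[ℝ] E) fun q : M ↦
          TangentSpace 𝓘(ℝ, E) q →L[ℝ] TangentSpace 𝓘(ℝ, E) q)) p :=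
  ContMDiffAt.sum_section (V := fun q : M ↦
    TangentSpace 𝓘(ℝ, E) q →L[ℝ] TangentSpace 𝓘(ℝ, E) q)
    (t := fun a q ↦ (mvfderiv 𝓘(ℝ, E) (fun q ↦ α.inner q (w a q) (Y q)) q).smulRight (w (τ a) q))
    fun a _ ↦ contMDiffAt_mvfderiv_smulRight (contMDiffAt_inner α (h.smooth a p hp) hY)
      (h.smooth (τ a) p hp)

/-- With `f a = α(w a, Y)` one has `α(Y, Y) = ∑ f a * f (τ a)`. The product rule yields two sums
exchanged by `τ`, each equal to `α(∇Y, Y)`. -/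
theorem metric (h : IsAdaptedFrame α β w τ U) {Y : Π p : M, TangentSpace 𝓘(ℝ, E) p} {p : M}
    (hp : p ∈ U) (hY : IsSmoothFieldAt Y p) (v : TangentSpace 𝓘(ℝ, E) p) :
    mvfderiv 𝓘(ℝ, E) (fun q ↦ α.inner q (Y q) (Y q)) p v =
      2 * α.inner p (frameConnection α w τ Y p v) (Y p) := by
  set f : ι → M → ℝ := fun a q ↦ α.inner q (w a q) (Y q)
  have hf : ∀ a, MDifferentiableAt 𝓘(ℝ, E) 𝓘(ℝ, ℝ) (f a) p := fun a ↦
    mdifferentiableAt_inner α (h.smooth a p hp).isDifferentiableFieldAt hY.isDifferentiableFieldAt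
  have hev : (fun q ↦ α.inner q (Y q) (Y q)) =ᶠ[𝓝 p] fun q ↦ ∑ a, (f a * f (τ a)) q := by
    filter_upwards [h.isOpen.mem_nhds hp] with q hq
    nth_rw 1 [← h.sum_eq q hq (Y q)]
    simp [f]
  rw [mvfderiv_congr hev, (mvfderiv_sum _ fun a _ ↦ (hf a).mul (hf (τ a))).2]
  have h1 : ∑ a, f a p * mvfderiv 𝓘(ℝ, E) (f (τ a)) p v =
      ∑ a, f (τ a) p * mvfderiv 𝓘(ℝ, E) (f a) p v := by
    rw [← Equiv.sum_comp τ]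
    simp only [h.involutive]
  have h2 : α.inner p (frameConnection α w τ Y p v) (Y p) =
      ∑ a, f (τ a) p * mvfderiv 𝓘(ℝ, E) (f a) p v := by
    simp [frameConnection, f, mul_comm]
  rw [h2, two_mul]
  nth_rw 1 [← h1]
  rw [← Finset.sum_add_distrib]
  simp [mvfderiv_mul (hf _) (hf _)]

/-- In `β(Y) = ∑ β(w (τ a)) α(w a, Y)` the first factors are constant, so differentiation only hits
the second ones. -/
theorem parallel (h : IsAdaptedFrame α β w τ U) {Y : Π p : M, TangentSpace 𝓘(ℝ, E) p} {p : M}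
    (hp : p ∈ U) (hY : IsSmoothFieldAt Y p) (v : TangentSpace 𝓘(ℝ, E) p) :
    mvfderiv 𝓘(ℝ, E) (fun q ↦ β q (Y q)) p v = β p (frameConnection α w τ Y p v) := by
  choose k hk using h.const
  set f : ι → M → ℝ := fun a q ↦ α.inner q (w a q) (Y q)
  have hf : ∀ a, MDifferentiableAt 𝓘(ℝ, E) 𝓘(ℝ, ℝ) (f a) p := fun a ↦
    mdifferentiableAt_inner α (h.smooth a p hp).isDifferentiableFieldAt hY.isDifferentiableFieldAt
  have hev : (fun q ↦ β q (Y q)) =ᶠ[𝓝 p] fun q ↦ ∑ a, ((fun _ : M ↦ k (τ a)) * f a : M → ℝ) q := by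
    filter_upwards [h.isOpen.mem_nhds hp] with q hq
    nth_rw 1 [← h.sum_eq q hq (Y q)]
    simp [f, hk _ q hq, mul_comm]
  rw [mvfderiv_congr hev, (mvfderiv_sum _ fun a _ ↦ mdifferentiableAt_const.mul (hf a)).2]
  simp [mvfderiv_mul mdifferentiableAt_const (hf _), mvfderiv_const, frameConnection, f,
    hk _ p hp, mul_comm]

end IsAdaptedFrame

end

section

/-! ### Existence of adapted frames -/

section LinearAlgebra

variable {V : Type*} [AddCommGroup V] [Module ℝ V] [TopologicalSpace V]

/-- For `g (b, b) = K ^ 2`, the orthogonal projection to the complement of `b`. -/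
def projCompl (g : V →L[ℝ] V →L[ℝ] ℝ) (b : V) (K : ℝ) : V →ₗ[ℝ] V :=
  LinearMap.id - (((K ^ 2)⁻¹ • g b : V →L[ℝ] ℝ) : V →ₗ[ℝ] ℝ).smulRight b

variable {g : V →L[ℝ] V →L[ℝ] ℝ} {b : V} {K : ℝ}

theorem projCompl_apply (v : V) : projCompl g b K v = v - ((K ^ 2)⁻¹ * g b v) • b := by
  simp [projCompl]

theorem inner_projCompl_right (hK : K ≠ 0) (hb : g b b = K ^ 2) (v : V) :
    g b (projCompl g b K v) = 0 := by
  rw [projCompl_apply]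
  simp [hb]
  field_simp
  ring

theorem inner_projCompl (hs : ∀ v w, g v w = g w v) (v w : V) :
    g (projCompl g b K v) w = g v (projCompl g b K w) := by
  simp [projCompl_apply, hs v b]
  ring

theorem projCompl_projCompl (hK : K ≠ 0) (hb : g b b = K ^ 2) (v : V) :
    projCompl g b K (projCompl g b K v) = projCompl g b K v := by
  nth_rw 1 [projCompl_apply]
  simp [inner_projCompl_right hK hb]

/-- The projection `P` is `g`-symmetric and idempotent, so the dual expansion by `e` and `s`
projects to `P y`, with the roles of `e` and `s` in either order. Averaging both orders makes the
sum invariant under their exchange; the `b` term supplies `y - P y`. -/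
theorem sum_frame_eq (hs : ∀ v w, g v w = g w v) (hpos : ∀ v, v ≠ 0 → 0 < g v v)
    (hK : K ≠ 0) (hb : g b b = K ^ 2) {κ : Type*} [Fintype κ] (e s : κ → V)
    (h : ∀ z, ∑ k, g (s k) z • e k = z) (y : V) :
    g (K⁻¹ • b) y • (K⁻¹ • b) +
      (∑ k, g (projCompl g b K (e k)) y • ((1 / 2 : ℝ) • projCompl g b K (s k)) +
        ∑ k, g ((1 / 2 : ℝ) • projCompl g b K (s k)) y • projCompl g b K (e k)) = y := by
  set P := projCompl g b K with hP
  have h1 : ∑ k, g (P (s k)) y • P (e k) = P y := by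
    simp only [hP, inner_projCompl hs, ← map_smul, ← map_sum, h, projCompl_projCompl hK hb]
  -- The transpose of `h1`, tested against every `z` and concluded by definiteness.
  have h2 : ∑ k, g (P (e k)) y • P (s k) = P y := by
    have key : ∀ z, g (∑ k, g (P (e k)) y • P (s k)) z = g (P y) z := by
      intro z
      calc g (∑ k, g (P (e k)) y • P (s k)) z = g (∑ k, g (s k) (P z) • e k) (P y) := by
            simp only [hP, map_sum, map_smul, sum_apply, smul_apply, smul_eq_mul,
              inner_projCompl hs]
            exact Finset.sum_congr rfl fun k _ ↦ mul_comm _ _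
        _ = g (P y) z := by
            rw [h, hP, inner_projCompl hs, projCompl_projCompl hK hb, hs]
    rw [← sub_eq_zero]
    by_contra hne
    refine (hpos _ hne).ne' ?_
    simp only [map_sub, sub_apply, key, sub_self]
  have h3 : ∑ k, g (P (e k)) y • ((1 / 2 : ℝ) • P (s k)) = (1 / 2 : ℝ) • P y := by
    rw [← h2, Finset.smul_sum]
    exact Finset.sum_congr rfl fun k _ ↦ smul_comm _ _ _
  have h4 : ∑ k, g ((1 / 2 : ℝ) • P (s k)) y • P (e k) = (1 / 2 : ℝ) • P y := by
    rw [← h1, Finset.smul_sum]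
    exact Finset.sum_congr rfl fun k _ ↦ by simp [mul_smul]
  rw [h3, h4, hP, projCompl_apply]
  simp only [map_smul, smul_apply, smul_eq_mul]
  have : (K ^ 2)⁻¹ = K⁻¹ * K⁻¹ := by rw [sq, mul_inv]
  rw [this]
  module

end LinearAlgebra

variable {E : Type*} [NormedAddCommGroup E] [NormedSpace ℝ E]
  {M : Type*} [TopologicalSpace M] [ChartedSpace E M] [IsManifold 𝓘(ℝ, E) ∞ M]

/-- The coordinate 1-forms of the chart at `x₀`. -/
def coordForm (x₀ : M) (φ : E →L[ℝ] ℝ) (p : M) : TangentSpace 𝓘(ℝ, E) p →L[ℝ] ℝ :=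
  φ ∘L (trivializationAt E (TangentSpace 𝓘(ℝ, E)) x₀).continuousLinearMapAt ℝ p

theorem isSmoothOneFormAt_coordForm {x₀ p : M} (hp : p ∈ (chartAt E x₀).source)
    (φ : E →L[ℝ] ℝ) : IsSmoothOneFormAt (coordForm x₀ φ) p := by
  have hpp := mem_chart_source E p
  rw [isSmoothOneFormAt_iff]
  have h : ContMDiffAt 𝓘(ℝ, E) 𝓘(ℝ, E →L[ℝ] E) ∞
      (fun q ↦ ((trivializationAt E (TangentSpace 𝓘(ℝ, E)) p).coordChangeL ℝ
        (trivializationAt E (TangentSpace 𝓘(ℝ, E)) x₀) q : E →L[ℝ] E)) p :=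
    contMDiffAt_coordChangeL hpp hp
  refine ((contMDiffAt_const (c := φ)).clm_comp h).congr_of_eventuallyEq ?_
  filter_upwards [source_mem_nhds hp, source_mem_nhds hpp] with q hq hqp
  ext y
  rw [formCoord_apply _ hqp]
  simp only [coordForm, ContinuousLinearMap.comp_apply, ContinuousLinearEquiv.coe_coe]
  rw [Trivialization.coordChangeL_apply _ _ ⟨hqp, hq⟩, ← coord_eq hq]
  rfl

variable [FiniteDimensional ℝ E]

/-- The adapted frame on the domain of the chart at `x₀`, for `β^♯` of constant length `K`: it
consists of the normalized `β^♯` and of the projections to its orthogonal complement of the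
coordinate fields and of (half) the duals of the coordinate forms. -/
def adaptedFrame (α : RMetric E M) (β : Π p : M, TangentSpace 𝓘(ℝ, E) p →L[ℝ] ℝ) (K : ℝ) (x₀ : M)
    (a : Option (Fin (Module.finrank ℝ E) ⊕ Fin (Module.finrank ℝ E))) (p : M) :
    TangentSpace 𝓘(ℝ, E) p :=
  match a with
  | none => K⁻¹ • sharp α β p
  | some (.inl k) => projCompl (α.inner p) (sharp α β p) K
      (coordField x₀ (Module.finBasis ℝ E k) p)
  | some (.inr k) => (1 / 2 : ℝ) • projCompl (α.inner p) (sharp α β p) K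
      (sharp α (coordForm x₀ (LinearMap.toContinuousLinearMap ((Module.finBasis ℝ E).coord k))) p)

theorem isSmoothFieldAt_projCompl (α : RMetric E M) {β : Π p : M, TangentSpace 𝓘(ℝ, E) p →L[ℝ] ℝ}
    (hβ : IsSmoothOneForm β) (K : ℝ) {Y : Π p : M, TangentSpace 𝓘(ℝ, E) p} {p : M}
    (hY : IsSmoothFieldAt Y p) :
    IsSmoothFieldAt (fun q ↦ projCompl (α.inner q) (sharp α β q) K (Y q)) p := by
  have h1 : ContMDiffAt 𝓘(ℝ, E) 𝓘(ℝ, ℝ) ∞ (fun q ↦ (K ^ 2)⁻¹ * β q (Y q)) p :=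
    contMDiffAt_const.mul (IsSmoothOneFormAt.contMDiffAt_apply (hβ p) hY)
  have h2 := hY.sub_section (h1.smul_section (isSmoothFieldAt_sharp α (hβ p)))
  refine h2.congr_of_eventuallyEq (.of_forall fun q ↦ ?_)
  simp [projCompl_apply, inner_sharp]

/-- Constancy of the length enters twice: the projection formula uses one `K` everywhere, and `β`
takes the constant value `K` on `β^♯/K`. On the projected fields `β = α(β^♯, ·)` vanishes. -/
theorem isAdaptedFrame (α : RMetric E M) {β : Π p : M, TangentSpace 𝓘(ℝ, E) p →L[ℝ] ℝ}
    (hβ : IsSmoothOneForm β) {K : ℝ} (hK : 0 < K) (h : ∀ p : M, length α p (sharp α β p) = K)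
    (x₀ : M) : IsAdaptedFrame α β (adaptedFrame α β K x₀)
      (Equiv.optionCongr (Equiv.sumComm _ _)) (chartAt E x₀).source := by
  have hb : ∀ p, α.inner p (sharp α β p) (sharp α β p) = K ^ 2 := by
    intro p
    have := h p
    rw [length, Real.sqrt_eq_iff_mul_self_eq_of_pos hK] at this
    rw [← this, sq]
  refine ⟨(chartAt E x₀).open_source, ?_, ?_, ?_, ?_⟩
  · rintro (_ | _ | _) <;> rfl
  · rintro (_ | k | k) p hp
    · exact ContMDiffAt.const_smul_section (isSmoothFieldAt_sharp α (hβ p))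
    · exact isSmoothFieldAt_projCompl α hβ K (contMDiffAt_coordField hp _)
    · exact ContMDiffAt.const_smul_section (isSmoothFieldAt_projCompl α hβ K
        (isSmoothFieldAt_sharp α (isSmoothOneFormAt_coordForm hp _)))
  · intro p hp y
    rw [Fintype.sum_option, Fintype.sum_sum_type]
    refine sum_frame_eq (α.symm p) (α.pos p) hK.ne' (hb p)
      (fun k ↦ coordField x₀ (Module.finBasis ℝ E k) p) (fun k ↦ sharp α (coordForm x₀
        (LinearMap.toContinuousLinearMap ((Module.finBasis ℝ E).coord k))) p) (fun z ↦ ?_) y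
    -- The duality hypothesis, `z = ∑ dx^k(z) ∂_k`, is checked in components.
    apply coord_injective hp
    simp only [inner_sharp, coordForm, ContinuousLinearMap.comp_apply, ← coord_eq hp]
    rw [coord_eq hp, map_sum]
    simp only [map_smul]
    simp only [← coord_eq hp, coord_coordField hp]
    exact (Module.finBasis ℝ E).sum_repr _
  · rintro (_ | k | k)
    · refine ⟨K, fun p _ ↦ ?_⟩
      rw [← inner_sharp α β]
      simp only [adaptedFrame, map_smul, hb, smul_eq_mul]
      field_simp
    · exact ⟨0, fun p _ ↦ by
        rw [← inner_sharp α β]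
        exact inner_projCompl_right hK.ne' (hb p) _⟩
    · refine ⟨0, fun p _ ↦ ?_⟩
      rw [← inner_sharp α β]
      simp only [adaptedFrame, map_smul, inner_projCompl_right hK.ne' (hb p), smul_zero]

/-! ### The global connection -/

variable [T2Space M] [SigmaCompactSpace M]

/-- The Leibniz rule, `∇α = 0` and `∇β = 0` are affine in `∇`, so they survive averaging with
weights of sum one. -/
theorem exists_isMetricAndParallel (α : RMetric E M)
    {β : Π p : M, TangentSpace 𝓘(ℝ, E) p →L[ℝ] ℝ} (hβ : IsSmoothOneForm β) {K : ℝ} (hK : 0 < K)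
    (h : ∀ p : M, length α p (sharp α β p) = K) :
    ∃ cov : LinearConnection E M, CovariantDerivative.ContMDiffCovariantDerivative cov ∞ ∧
      IsMetricAndParallel cov α β := by
  obtain ⟨ρ, hρ⟩ := SmoothPartitionOfUnity.exists_isSubordinate_chartAt_source 𝓘(ℝ, E) M
  set D : M → (Π p : M, TangentSpace 𝓘(ℝ, E) p) → Π p : M,
      TangentSpace 𝓘(ℝ, E) p →L[ℝ] TangentSpace 𝓘(ℝ, E) p := fun x₀ ↦
    frameConnection α (adaptedFrame α β K x₀) (Equiv.optionCongr (Equiv.sumComm _ _)) with hD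
  have hfr := isAdaptedFrame α hβ hK h
  have hDcov : ∀ i, IsCovariantDerivativeOn (I := 𝓘(ℝ, E)) E (D i) (chartAt E i).source :=
    fun i ↦ (hfr i).isCovariantDerivativeOn
  have hmem : ∀ p, ∀ i ∈ ρ.finsupport p, p ∈ (chartAt E i).source := fun p i hi ↦
    hρ i (subset_tsupport _ ((ρ.mem_finsupport p).1 hi))
  have hsum : ∀ p, ∑ i ∈ ρ.finsupport p, ρ i p = 1 := fun p ↦ ρ.sum_finsupport p (mem_univ p)
  have hone : ∀ p (r : ℝ), r = ∑ i ∈ ρ.finsupport p, ρ i p * r := by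
    intro p r
    rw [← Finset.sum_mul, hsum, one_mul]
  have hcov : IsCovariantDerivativeOn (I := 𝓘(ℝ, E)) E
      (fun Y (p : M) ↦ ∑ i ∈ ρ.finsupport p, ρ i p • D i Y p) univ :=
    { add := by
        intro Y Z p hY hZ _
        rw [← Finset.sum_add_distrib]
        refine Finset.sum_congr rfl fun i hi ↦ ?_
        rw [(hDcov i).add hY hZ (hmem p i hi), smul_add]
      leibniz := by
        intro Y g p hY hg _
        have : ∀ i ∈ ρ.finsupport p, ρ i p • D i (g • Y) p = g p • ρ i p • D i Y p +
            ρ i p • (mvfderiv 𝓘(ℝ, E) g p).smulRight (Y p) := by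
          intro i hi
          rw [(hDcov i).leibniz hY hg (hmem p i hi), smul_add, smul_comm]
        rw [Finset.sum_congr rfl this, Finset.sum_add_distrib, ← Finset.smul_sum,
          ← Finset.sum_smul, hsum, one_smul] }
  refine ⟨⟨_, hcov⟩, ⟨⟨fun {Y} hY ↦ ?_⟩⟩, ?_, ?_⟩
  · have hY' : ∀ p, IsSmoothFieldAt Y p := contMDiffOn_univ.1 hY
    -- The index set `ρ.finsupport p` varies with `p`; smoothness is proved for the equal locally
    -- finite sum over all indices.
    have hfin : ContMDiff 𝓘(ℝ, E) (𝓘(ℝ, E).prod 𝓘(ℝ, E →L[ℝ] E)) ∞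
        (fun q ↦ (TotalSpace.mk' (E →L[ℝ] E) q (∑ᶠ i, ρ i q • D i Y q) :
          TotalSpace (E →L[ℝ] E) fun q : M ↦
            TangentSpace 𝓘(ℝ, E) q →L[ℝ] TangentSpace 𝓘(ℝ, E) q)) := by
      refine ContMDiff.finsum_section_of_locallyFinite (𝕜 := ℝ) (F := E →L[ℝ] E)
        (V := fun q : M ↦ TangentSpace 𝓘(ℝ, E) q →L[ℝ] TangentSpace 𝓘(ℝ, E) q)
        (t := fun i q ↦ ρ i q • D i Y q) (ρ.locallyFinite.subset fun i q hq ↦ ?_) fun i ↦ ?_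
      · exact fun h0 ↦ hq (by simp [h0])
      · exact ContMDiffOn.smul_section_of_tsupport (𝕜 := ℝ) (F := E →L[ℝ] E)
          (V := fun q : M ↦ TangentSpace 𝓘(ℝ, E) q →L[ℝ] TangentSpace 𝓘(ℝ, E) q)
          (ρ i).contMDiff.contMDiffOn (chartAt E i).open_source (hρ i) fun p hp ↦
            ((hfr i).contMDiffAt_frameConnection hp (hY' p)).contMDiffWithinAt
    refine contMDiffOn_univ.2 (hfin.congr fun q ↦ ?_)
    rw [← ρ.sum_finsupport_smul_eq_finsum q (fun i _ ↦ D i Y q)]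
  · intro p Y hY v
    rw [hone p (mvfderiv 𝓘(ℝ, E) _ p v)]
    simp only [sum_apply, smul_apply, map_sum, map_smul, smul_eq_mul, Finset.mul_sum]
    refine Finset.sum_congr rfl fun i hi ↦ ?_
    rw [(hfr i).metric (hmem p i hi) hY]
    ring
  · intro p Y hY v
    rw [hone p (mvfderiv 𝓘(ℝ, E) _ p v)]
    simp only [sum_apply, smul_apply, map_sum, map_smul, smul_eq_mul]
    exact Finset.sum_congr rfl fun i hi ↦ by rw [(hfr i).parallel (hmem p i hi) hY]

end

section

/-! ### Local existence of parallel vector fields -/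

variable {E : Type*} [NormedAddCommGroup E] [NormedSpace ℝ E]
  {M : Type*} [TopologicalSpace M] [ChartedSpace E M] [IsManifold 𝓘(ℝ, E) ∞ M]

/-- The change of tangent coordinates from the chart at `x₀` to the chart at `x₁`. -/
def coordChange (x₀ x₁ p : M) : E →L[ℝ] E :=
  ((trivializationAt E (TangentSpace 𝓘(ℝ, E)) x₀).coordChangeL ℝ
    (trivializationAt E (TangentSpace 𝓘(ℝ, E)) x₁) p : E →L[ℝ] E)

theorem coordChange_apply {x₀ x₁ p : M} (h₀ : p ∈ (chartAt E x₀).source)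
    (h₁ : p ∈ (chartAt E x₁).source) (y : E) :
    coordChange x₀ x₁ p y = coord x₁ p (coordField x₀ y p) := by
  rw [coordChange, ContinuousLinearEquiv.coe_coe, Trivialization.coordChangeL_apply _ _ ⟨h₀, h₁⟩]
  rfl

theorem coordChange_coord {x₀ x₁ p : M} (h₀ : p ∈ (chartAt E x₀).source)
    (h₁ : p ∈ (chartAt E x₁).source) (v : TangentSpace 𝓘(ℝ, E) p) :
    coordChange x₀ x₁ p (coord x₀ p v) = coord x₁ p v := by
  rw [coordChange_apply h₀ h₁, coordField_coord h₀]

theorem mdifferentiableAt_coordChange {x₀ x₁ p : M} (h₀ : p ∈ (chartAt E x₀).source)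
    (h₁ : p ∈ (chartAt E x₁).source) :
    MDifferentiableAt 𝓘(ℝ, E) 𝓘(ℝ, E →L[ℝ] E) (coordChange (E := E) x₀ x₁) p := by
  have h : ContMDiffAt 𝓘(ℝ, E) 𝓘(ℝ, E →L[ℝ] E) ∞ (coordChange (E := E) x₀ x₁) p := by
    unfold coordChange
    exact contMDiffAt_coordChangeL h₀ h₁
  exact h.mdifferentiableAt (by simp)

/-- The equation of parallel vector fields is independent of the chart. -/
theorem hasDerivWithinAt_coord_of_hasDerivWithinAt_coord [FiniteDimensional ℝ E]
    (cov : LinearConnection E M) {c : ℝ → M} {t : ℝ} (ht : t ∈ Icc (0 : ℝ) 1)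
    (hc : MDifferentiableWithinAt 𝓘(ℝ, ℝ) 𝓘(ℝ, E) c (Icc 0 1) t)
    {X : Π s : ℝ, TangentSpace 𝓘(ℝ, E) (c s)} {x₀ x₁ : M}
    (h₀ : c t ∈ (chartAt E x₀).source) (h₁ : c t ∈ (chartAt E x₁).source)
    (hX : HasDerivWithinAt (fun s ↦ coord x₀ (c s) (X s))
      (-coord x₀ (c t) (cov (coordField x₀ (coord x₀ (c t) (X t))) (c t) (velocity c t)))
      (Icc 0 1) t) :
    HasDerivWithinAt (fun s ↦ coord x₁ (c s) (X s))
      (-coord x₁ (c t) (cov (coordField x₁ (coord x₁ (c t) (X t))) (c t) (velocity c t)))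
      (Icc 0 1) t := by
  have hu : UniqueDiffWithinAt ℝ (Icc (0 : ℝ) 1) t := uniqueDiffOn_Icc zero_lt_one t ht
  have hev₀ := eventually_curve_mem_source hc.continuousWithinAt h₀
  have hev₁ := eventually_curve_mem_source hc.continuousWithinAt h₁
  have hT := hasDerivWithinAt_comp_curve (mdifferentiableAt_coordChange h₀ h₁) hc
  have hS := hasDerivWithinAt_comp_curve (mdifferentiableAt_coordChange h₁ h₀) hc
  obtain ⟨z, hz⟩ : ∃ z, HasDerivWithinAt (fun s ↦ coord x₁ (c s) (X s)) z (Icc 0 1) t := by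
    refine ⟨_, (hT.clm_apply hX).congr_of_eventuallyEq ?_ ?_⟩
    · filter_upwards [hev₀, hev₁] with s hs₀ hs₁ using (coordChange_coord hs₀ hs₁ _).symm
    · exact (coordChange_coord h₀ h₁ _).symm
  refine hz.congr_deriv ?_
  -- Transforming back to the first chart and comparing with `hX` determines `z`.
  have h2 : HasDerivWithinAt (fun s ↦ coord x₀ (c s) (X s))
      (mvfderiv 𝓘(ℝ, E) (coordChange (E := E) x₁ x₀) (c t) (velocity c t) (coord x₁ (c t) (X t)) +
        coordChange x₁ x₀ (c t) z) (Icc 0 1) t := by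
    refine (hS.clm_apply hz).congr_of_eventuallyEq ?_ ?_
    · filter_upwards [hev₀, hev₁] with s hs₀ hs₁ using (coordChange_coord hs₁ hs₀ _).symm
    · exact (coordChange_coord h₁ h₀ _).symm
  have h3 := hu.eq_deriv _ hX h2
  set y := coord x₁ (c t) (X t)
  -- This is the transformation law of the Christoffel symbols; the derivative of the coordinate
  -- change is its inhomogeneous term.
  have h4 := coord_cov cov h₀ (mdifferentiableAt_coordField h₁ y) (velocity c t)
  have hy : coordField x₁ y (c t) = X t := coordField_coord h₁ _
  have h5 : mvfderiv 𝓘(ℝ, E) (fun q ↦ coord x₀ q (coordField x₁ y q)) (c t) (velocity c t) =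
      mvfderiv 𝓘(ℝ, E) (coordChange (E := E) x₁ x₀) (c t) (velocity c t) y := by
    have e : (fun q ↦ coord x₀ q (coordField x₁ y q)) =ᶠ[𝓝 (c t)]
        fun q ↦ coordChange x₁ x₀ q y := by
      filter_upwards [source_mem_nhds h₀, source_mem_nhds h₁] with q hq₀ hq₁ using
        (coordChange_apply hq₁ hq₀ y).symm
    rw [mvfderiv_congr e]
    have h7 : MDifferentiableAt 𝓘(ℝ, E) 𝓘(ℝ, E) (fun q ↦ coordChange x₁ x₀ q y) (c t) :=
      (mdifferentiableAt_coordChange h₁ h₀).clm_apply mdifferentiableAt_const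
    have h8 := hu.eq_deriv _ (hasDerivWithinAt_comp_curve h7 hc)
      (hS.clm_apply (hasDerivWithinAt_const t _ y))
    simpa using h8
  rw [hy, h5, ← coordChange_coord h₁ h₀ (cov (coordField x₁ y) (c t) (velocity c t))] at h4
  have h6 : coordChange x₁ x₀ (c t) z = coordChange x₁ x₀ (c t)
      (-coord x₁ (c t) (cov (coordField x₁ y) (c t) (velocity c t))) := by
    rw [map_neg, h4, neg_add, h3]
    abel
  have h7 := congrArg (coordChange x₀ x₁ (c t)) h6
  have h8 : ∀ z, coordChange x₀ x₁ (c t) (coordChange x₁ x₀ (c t) z) = z := fun z ↦ by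
    rw [coordChange_apply h₁ h₀, coordChange_coord h₀ h₁, coord_coordField h₁]
  rwa [h8, h8] at h7

end

/-! ### Christoffel symbols and the linear parallel equation. -/

section

variable {E : Type*} [NormedAddCommGroup E] [NormedSpace ℝ E] [FiniteDimensional ℝ E]
  {M : Type*} [TopologicalSpace M] [ChartedSpace E M] [IsManifold 𝓘(ℝ, E) ∞ M]

/-- The Christoffel symbols of a connection in the chart at `x₀`, as a bilinear map. -/
def christoffel (cov : LinearConnection E M) (x₀ p : M) : E →L[ℝ] E →L[ℝ] E :=
  ∑ k, (LinearMap.toContinuousLinearMap ((Module.finBasis ℝ E).coord k)).smulRight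
    (ContinuousLinearMap.inCoordinates E (TangentSpace 𝓘(ℝ, E)) E (TangentSpace 𝓘(ℝ, E)) x₀ p x₀ p
      (cov (coordField x₀ (Module.finBasis ℝ E k)) p))

theorem christoffel_apply (cov : LinearConnection E M) {x₀ p : M}
    (hp : p ∈ (chartAt E x₀).source) (y : E) (v : TangentSpace 𝓘(ℝ, E) p) :
    christoffel cov x₀ p y (coord x₀ p v) = coord x₀ p (cov (coordField x₀ y) p v) := by
  let L : E →ₗ[ℝ] E :=
    { toFun := fun y ↦ coord x₀ p (cov (coordField x₀ y) p v)
      map_add' := fun y z ↦ by rw [cov_coordField_add cov hp, add_apply, coord_add hp]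
      map_smul' := fun a y ↦ by
        rw [cov_coordField_smul cov hp, smul_apply, coord_smul hp, RingHom.id_apply] }
  change _ = L y
  conv_rhs => rw [← (Module.finBasis ℝ E).sum_repr y, map_sum]
  simp only [christoffel, sum_apply]
  refine Finset.sum_congr rfl fun k _ ↦ ?_
  rw [map_smul, ContinuousLinearMap.smulRight_apply, smul_apply]
  congr 1
  change _ = coord x₀ p (cov (coordField x₀ (Module.finBasis ℝ E k)) p v)
  rw [ContinuousLinearMap.inCoordinates_eq hp hp]
  simp only [ContinuousLinearMap.comp_apply, ContinuousLinearEquiv.coe_coe]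
  nth_rw 2 [← coordField_coord hp v]
  rfl

/-- Smoothness of `cov` concerns globally smooth fields, so the coordinate field is cut off by a
bump function equal to one near `x₀`; locality of `cov` removes the cutoff. -/
theorem contMDiffAt_cov_coordField [T2Space M] {cov : LinearConnection E M}
    (hcov : CovariantDerivative.ContMDiffCovariantDerivative cov ∞) (x₀ : M) (y : E) :
    ContMDiffAt 𝓘(ℝ, E) 𝓘(ℝ, E →L[ℝ] E) ∞ (fun p ↦ ContinuousLinearMap.inCoordinates E
      (TangentSpace 𝓘(ℝ, E)) E (TangentSpace 𝓘(ℝ, E)) x₀ p x₀ p (cov (coordField x₀ y) p)) x₀ := by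
  obtain ⟨χ⟩ : Nonempty (SmoothBumpFunction 𝓘(ℝ, E) x₀) := inferInstance
  have h1 : ContMDiff 𝓘(ℝ, E) (𝓘(ℝ, E).prod 𝓘(ℝ, E)) ∞
      (fun q ↦ TotalSpace.mk' E q (((χ : M → ℝ) • coordField x₀ y) q)) :=
    ContMDiffOn.smul_section_of_tsupport χ.contMDiff.contMDiffOn (chartAt E x₀).open_source
      χ.tsupport_subset_chartAt_source fun p hp ↦ (contMDiffAt_coordField hp y).contMDiffWithinAt
  have h2 := (hcov.contMDiff.contMDiff h1.contMDiffOn).contMDiffAt (x := x₀) univ_mem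
  refine ((contMDiffAt_hom_bundle _).1 h2).2.congr_of_eventuallyEq ?_
  filter_upwards [χ.eventuallyEq_one.eventuallyEq_nhds, source_mem_nhds (mem_chart_source E x₀)]
    with p hp hps
  congr 1
  refine cov.isCovariantDerivativeOnUniv.congr_of_eventuallyEq (mdifferentiableAt_coordField hps y)
    (h1.mdifferentiable (by simp) p) univ_mem ?_
  filter_upwards [hp] with q hq
  simp [hq]

theorem eventually_continuousAt_christoffel [T2Space M] {cov : LinearConnection E M}
    (hcov : CovariantDerivative.ContMDiffCovariantDerivative cov ∞) (x₀ : M) :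
    ∀ᶠ p in 𝓝 x₀, ContinuousAt (christoffel cov x₀) p := by
  have : IsManifold 𝓘(ℝ, E) 1 M := IsManifold.of_le (n := ∞) (by simp)
  -- The order is lowered to 1 because only a finite order at a point propagates to a neighbourhood.
  have h := fun k ↦ (contMDiffAt_iff_contMDiffAt_nhds (by simp)).1
    ((contMDiffAt_cov_coordField hcov x₀ (Module.finBasis ℝ E k)).of_le
      (by simp : (1 : ℕ∞ω) ≤ ∞))
  filter_upwards [eventually_all.2 h] with p hp
  unfold christoffel
  refine tendsto_finsetSum _ fun k _ ↦ ?_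
  let L : (E →L[ℝ] E) →L[ℝ] E →L[ℝ] E →L[ℝ] E := ContinuousLinearMap.smulRightL ℝ E (E →L[ℝ] E)
    (LinearMap.toContinuousLinearMap ((Module.finBasis ℝ E).coord k))
  exact L.continuous.continuousAt.comp (hp k).continuousAt

/-- The linear equation `x' = A x` has a solution on `[0, 1]` if `A` is small. -/
theorem exists_hasDerivWithinAt_linear {A : ℝ → E →L[ℝ] E} (hA : ContinuousOn A (Icc 0 1))
    (hA' : ∀ t ∈ Icc (0 : ℝ) 1, ‖A t‖ ≤ 1 / 2) (x : E) :
    ∃ f : ℝ → E, f 0 = x ∧ ∀ t ∈ Icc (0 : ℝ) 1, HasDerivWithinAt f (A t (f t)) (Icc 0 1) t := by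
  -- On the ball of radius `‖x‖` about `x` one has `‖y‖ ≤ 2‖x‖`, so the speed is at most `‖x‖` and a
  -- solution cannot leave the ball in unit time.
  have h : IsPicardLindelof (fun t y ↦ A t y) (tmin := 0) (tmax := 1)
      ⟨0, left_mem_Icc.2 zero_le_one⟩ x ‖x‖₊ 0 ‖x‖₊ (1 / 2) :=
    { lipschitzOnWith := fun t ht ↦ by
        refine ((A t).lipschitz.weaken ?_).lipschitzOnWith
        exact_mod_cast hA' t ht
      continuousOn := fun y _ ↦ hA.clm_apply continuousOn_const
      norm_le := fun t ht y hy ↦ by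
        have h1 : ‖y‖ ≤ 2 * ‖x‖ := by
          have h2 : ‖y - x‖ ≤ ‖x‖ := by simpa [dist_eq_norm] using hy
          have := norm_le_norm_add_norm_sub' y x
          linarith
        calc ‖A t y‖ ≤ ‖A t‖ * ‖y‖ := (A t).le_opNorm y
          _ ≤ 1 / 2 * (2 * ‖x‖) := by gcongr; exact hA' t ht
          _ = ‖x‖₊ := by simp
      mul_max_le := by simp }
  exact h.exists_eq_forall_mem_Icc_hasDerivWithinAt₀

end

/-! ### Short segments and the Cauchy–Schwarz inequality. -/

section

variable {E : Type*} [NormedAddCommGroup E] [NormedSpace ℝ E]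
  {M : Type*} [TopologicalSpace M] [ChartedSpace E M] [IsManifold 𝓘(ℝ, E) ∞ M]

theorem mvfderiv_chartAt {x₀ p : M} (hp : p ∈ (chartAt E x₀).source)
    (v : TangentSpace 𝓘(ℝ, E) p) : mvfderiv 𝓘(ℝ, E) (chartAt E x₀) p v = coord x₀ p v := by
  rw [coord_eq hp]
  have : IsManifold 𝓘(ℝ, E) 1 M := IsManifold.of_le (n := ∞) (by simp)
  rw [TangentBundle.continuousLinearMapAt_trivializationAt hp]
  rfl

/-- The curve from `p` to `q` which is a line segment in the chart at `x₀`. -/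
def segmentCurve (x₀ p q : M) (t : ℝ) : M :=
  (chartAt E x₀).symm (AffineMap.lineMap (chartAt E x₀ p) (chartAt E x₀ q) t)

/-- The reflection of a parallel vector field is parallel. -/
theorem IsParallelAlong.neg {cov : LinearConnection E M} {c : ℝ → M}
    (hc : ContinuousOn c (Icc 0 1)) {X : Π t : ℝ, TangentSpace 𝓘(ℝ, E) (c t)}
    (hX : IsParallelAlong cov c X) : IsParallelAlong cov c (fun t ↦ -X t) := by
  intro x₀ t ht h
  refine ((hX x₀ t ht h).neg.congr_of_eventuallyEq ?_ ?_).congr_deriv ?_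
  · filter_upwards [eventually_curve_mem_source (hc t ht) h] with s hs using coord_neg hs _
  · exact coord_neg h _
  · rw [coord_neg h, cov_coordField_neg cov h, neg_apply, coord_neg h]

theorem inner_self_nonneg (α : RMetric E M) (p : M) (v : TangentSpace 𝓘(ℝ, E) p) :
    0 ≤ α.inner p v v := by
  rcases eq_or_ne v 0 with rfl | hv
  · simp
  · exact (α.pos p v hv).le

/-- Cauchy–Schwarz, from the nonnegativity of `α` on `α(w,w) v - α(v,w) w`. -/
theorem inner_mul_le (α : RMetric E M) (p : M) (v w : TangentSpace 𝓘(ℝ, E) p) :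
    α.inner p v w ^ 2 ≤ α.inner p v v * α.inner p w w := by
  rcases eq_or_ne w 0 with rfl | hw
  · simp
  have hw := α.pos p w hw
  have h1 := inner_self_nonneg α p (α.inner p w w • v - α.inner p v w • w)
  simp only [map_sub, map_smul, sub_apply, smul_apply, smul_eq_mul, α.symm p w v] at h1
  have h2 : 0 ≤ α.inner p w w * (α.inner p v v * α.inner p w w - α.inner p v w ^ 2) := by
    linarith
  linarith [nonneg_of_mul_nonneg_right h2 hw]

variable [FiniteDimensional ℝ E]

/-- Nearby points can be joined by curves along which every tangent vector extends to a parallel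
vector field. -/
theorem exists_mem_nhds_isParallelAlong [T2Space M] {cov : LinearConnection E M}
    (hcov : CovariantDerivative.ContMDiffCovariantDerivative cov ∞) (x₀ : M) :
    ∃ U ∈ 𝓝 x₀, ∀ p ∈ U, ∀ q ∈ U, ∃ c : ℝ → M, ContMDiffOn 𝓘(ℝ, ℝ) 𝓘(ℝ, E) ∞ c (Icc 0 1) ∧
      c 0 = p ∧ c 1 = q ∧ ∀ v : TangentSpace 𝓘(ℝ, E) (c 0),
        ∃ X : Π t : ℝ, TangentSpace 𝓘(ℝ, E) (c t), IsParallelAlong cov c X ∧ X 0 = v := by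
  set φ := chartAt E x₀ with hφ
  have hx₀ : x₀ ∈ φ.source := mem_chart_source E x₀
  set C : ℝ := ‖christoffel cov x₀ x₀‖ + 1 with hC
  have hC0 : 0 < C := by positivity
  have hcont := eventually_continuousAt_christoffel hcov x₀
  have hbd : ∀ᶠ p in 𝓝 x₀, ‖christoffel cov x₀ p‖ < C :=
    ((continuous_norm (E := E →L[ℝ] E →L[ℝ] E)).continuousAt.comp
      hcont.self_of_nhds).eventually_lt continuousAt_const (lt_add_one _)
  have hsymm : Tendsto φ.symm (𝓝 (φ x₀)) (𝓝 x₀) := by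
    have := φ.continuousAt_symm (φ.map_source hx₀)
    rwa [ContinuousAt, φ.left_inv hx₀] at this
  obtain ⟨ε, hε, hball⟩ := Metric.eventually_nhds_iff_ball.1
    ((hsymm.eventually (hcont.and hbd)).and (φ.open_target.mem_nhds (φ.map_source hx₀)))
  -- Then `‖φ q - φ p‖ ≤ 1 / (2C)`, and the bound `C` on the Christoffel symbols gives the constant
  -- `1 / 2` required by `exists_hasDerivWithinAt_linear`.
  set r := min ε (1 / (4 * C))
  have hr : 0 < r := by positivity
  refine ⟨φ.source ∩ φ ⁻¹' Metric.ball (φ x₀) r, ?_, ?_⟩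
  · exact inter_mem (source_mem_nhds hx₀)
      ((φ.continuousAt hx₀).preimage_mem_nhds (Metric.ball_mem_nhds _ hr))
  rintro p ⟨hp, hpr⟩ q ⟨hq, hqr⟩
  set ℓ : ℝ → E := fun t ↦ AffineMap.lineMap (φ p) (φ q) t with hℓ
  set c : ℝ → M := segmentCurve (E := E) x₀ p q
  have hℓball : ∀ t ∈ Icc (0 : ℝ) 1, ℓ t ∈ Metric.ball (φ x₀) ε := fun t ht ↦
    Metric.ball_subset_ball (min_le_left _ _) ((convex_ball (φ x₀) r).lineMap_mem hpr hqr ht)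
  have hℓt : ∀ t ∈ Icc (0 : ℝ) 1, ℓ t ∈ φ.target := fun t ht ↦ (hball _ (hℓball t ht)).2
  have hcs : ∀ t ∈ Icc (0 : ℝ) 1, c t ∈ φ.source := fun t ht ↦ φ.map_target (hℓt t ht)
  have hc : ContMDiffOn 𝓘(ℝ, ℝ) 𝓘(ℝ, E) ∞ c (Icc 0 1) := by
    refine (contMDiffOn_chart_symm (I := 𝓘(ℝ, E)) (x := x₀) (n := ∞)).comp ?_ hℓt
    have : ContDiff ℝ ∞ ℓ := by
      simp only [hℓ, AffineMap.lineMap_apply_module']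
      fun_prop
    exact this.contMDiff.contMDiffOn
  have hcd := fun t ht ↦ (hc t ht).mdifferentiableWithinAt (by simp : (∞ : ℕ∞ω) ≠ 0)
  have hvel : ∀ t ∈ Icc (0 : ℝ) 1, coord x₀ (c t) (velocity c t) = φ q - φ p := by
    intro t ht
    have hmd : MDifferentiableAt 𝓘(ℝ, E) 𝓘(ℝ, E) (chartAt E x₀) (c t) :=
      ((contMDiffOn_chart (I := 𝓘(ℝ, E)) (x := x₀) (n := ∞)).contMDiffAt
        (source_mem_nhds (hcs t ht))).mdifferentiableAt (by simp)
    have h1 := hasDerivWithinAt_comp_curve hmd (hcd t ht)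
    rw [mvfderiv_chartAt (hcs t ht)] at h1
    have h2 : HasDerivWithinAt (fun s ↦ φ (c s)) (φ q - φ p) (Icc 0 1) t := by
      refine HasDerivWithinAt.congr (f := ℓ) ?_ (fun s hs ↦ φ.right_inv (hℓt s hs))
        (φ.right_inv (hℓt t ht))
      exact AffineMap.hasDerivWithinAt_lineMap
    exact (uniqueDiffOn_Icc zero_lt_one t ht).eq_deriv _ h1 h2
  refine ⟨c, hc, ?_, ?_, fun v ↦ ?_⟩
  · simp [c, segmentCurve, ← hφ, φ.left_inv hp]
  · simp [c, segmentCurve, ← hφ, φ.left_inv hq]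
  -- The segment has constant velocity components `φ q - φ p`, so the parallel equation in this
  -- chart is `f' = A f`.
  set A : ℝ → E →L[ℝ] E := fun t ↦ -(christoffel cov x₀ (c t)).flip (φ q - φ p) with hA
  have hAc : ContinuousOn A (Icc 0 1) := by
    intro t ht
    have h1 : ContinuousWithinAt (fun t ↦ christoffel cov x₀ (c t)) (Icc 0 1) t :=
      (hball _ (hℓball t ht)).1.1.comp_continuousWithinAt (f := c) (hc t ht).continuousWithinAt
    have h2 : ContinuousWithinAt (fun t ↦ (christoffel cov x₀ (c t)).flip) (Icc 0 1) t :=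
      (ContinuousLinearMap.flipₗᵢ ℝ E E E).continuous.continuousAt.comp_continuousWithinAt h1
    exact (h2.clm_apply continuousWithinAt_const).neg
  have hAb : ∀ t ∈ Icc (0 : ℝ) 1, ‖A t‖ ≤ 1 / 2 := by
    intro t ht
    have h1 : ‖φ q - φ p‖ ≤ 2 * (1 / (4 * C)) := by
      have h2 : dist (φ q) (φ x₀) < 1 / (4 * C) := lt_of_lt_of_le hqr (min_le_right _ _)
      have h3 : dist (φ p) (φ x₀) < 1 / (4 * C) := lt_of_lt_of_le hpr (min_le_right _ _)
      rw [← dist_eq_norm]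
      linarith [dist_triangle_right (φ q) (φ p) (φ x₀)]
    calc ‖A t‖ ≤ ‖christoffel cov x₀ (c t)‖ * ‖φ q - φ p‖ := by
          rw [hA, norm_neg, ← ContinuousLinearMap.opNorm_flip (christoffel cov x₀ (c t))]
          exact ContinuousLinearMap.le_opNorm _ _
      _ ≤ C * (2 * (1 / (4 * C))) := by
          gcongr
          exact (hball _ (hℓball t ht)).1.2.le
      _ = 1 / 2 := by field_simp; norm_num
  obtain ⟨f, hf0, hf⟩ := exists_hasDerivWithinAt_linear hAc hAb (coord x₀ (c 0) v)
  have h0 : (0 : ℝ) ∈ Icc (0 : ℝ) 1 := left_mem_Icc.2 zero_le_one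
  refine ⟨fun t ↦ coordField x₀ (f t) (c t), fun x₁ t ht hx₁ ↦ ?_, ?_⟩
  · refine hasDerivWithinAt_coord_of_hasDerivWithinAt_coord cov ht (hcd t ht) (hcs t ht) hx₁ ?_
    have e := fun s hs ↦ coord_coordField (hcs s hs) (f s)
    rw [e t ht, ← christoffel_apply cov (hcs t ht), hvel t ht]
    exact (hf t ht).congr e (e t ht)
  · simp only [hf0]
    exact coordField_coord (hcs 0 h0) v

/-! ### Constancy of the length of the dual field. -/

variable {F : TangentBundle 𝓘(ℝ, E) M → ℝ} {α : RMetric E M}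
  {β : Π p : M, TangentSpace 𝓘(ℝ, E) p →L[ℝ] ℝ}

/-- If a parallel transport preserves a Randers metric, then `β^♯` does not get shorter along the
curve. -/
theorem length_sharp_le {cov : LinearConnection E M} (hF : IsRandersMetric F α β)
    (hcomp : IsCompatible cov F) {c : ℝ → M} (hc : ContMDiffOn 𝓘(ℝ, ℝ) 𝓘(ℝ, E) ∞ c (Icc 0 1))
    {X : Π t : ℝ, TangentSpace 𝓘(ℝ, E) (c t)} (hX : IsParallelAlong cov c X)
    (hX0 : X 0 = sharp α β (c 0)) :
    length α (c 0) (sharp α β (c 0)) ≤ length α (c 1) (sharp α β (c 1)) := by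
  have h1 := hcomp c hc _ _ ⟨X, hX, rfl, rfl⟩
  have h2 := hcomp c hc _ _ ⟨_, hX.neg hc.continuousOn, rfl, rfl⟩
  simp only [hF.eq_add, length, map_neg, neg_apply, neg_neg] at h1 h2
  -- Half the sum and half the difference of the preserved values at `X` and `-X`.
  have h3 : √(α.inner (c 1) (X 1) (X 1)) = √(α.inner (c 0) (X 0) (X 0)) := by linarith
  have h4 : β (c 1) (X 1) = β (c 0) (X 0) := by linarith
  rw [Real.sqrt_inj (inner_self_nonneg α _ _) (inner_self_nonneg α _ _)] at h3
  rw [hX0] at h3 h4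
  rw [← inner_sharp α β, ← inner_sharp α β] at h4
  -- With `b₀`, `b₁` the dual vectors at the two ends, this becomes `|b₀|⁴ ≤ |b₁|² |b₀|²`; one
  -- factor cancels unless `b₀ = 0`.
  have h5 := inner_mul_le α (c 1) (sharp α β (c 1)) (X 1)
  rw [h4, h3] at h5
  have h6 := inner_self_nonneg α (c 1) (sharp α β (c 1))
  refine Real.sqrt_le_sqrt ?_
  rcases (inner_self_nonneg α (c 0) (sharp α β (c 0))).eq_or_lt with h | h
  · rwa [← h]
  · rw [sq] at h5
    exact le_of_mul_le_mul_right h5 h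

theorem isLocallyConstant_length_sharp [T2Space M] (hF : IsRandersMetric F α β)
    (hB : IsGeneralizedBerwald F) : IsLocallyConstant fun p ↦ length α p (sharp α β p) := by
  obtain ⟨cov, hcov, hcomp⟩ := hB
  rw [IsLocallyConstant.iff_eventually_eq]
  intro x₀
  obtain ⟨U, hU, h⟩ := exists_mem_nhds_isParallelAlong hcov x₀
  have key : ∀ p ∈ U, ∀ q ∈ U, length α p (sharp α β p) ≤ length α q (sharp α β q) := by
    intro p hp q hq
    obtain ⟨c, hc, rfl, rfl, hpar⟩ := h p hp q hq
    obtain ⟨X, hX, hX0⟩ := hpar (sharp α β (c 0))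
    exact length_sharp_le hF hcomp hc hX hX0
  filter_upwards [hU] with p hp
  exact (key p hp x₀ (mem_of_mem_nhds hU)).antisymm (key x₀ (mem_of_mem_nhds hU) p hp)

theorem isRiemannian_of_length_sharp_eq_zero (hF : IsRandersMetric F α β)
    (h : ∀ p, length α p (sharp α β p) = 0) : IsRiemannian F := by
  refine ⟨α, fun p v ↦ ?_⟩
  have h0 : sharp α β p = 0 := by
    by_contra hne
    exact (Real.sqrt_pos.2 (α.pos p _ hne)).ne' (h p)
  rw [hF.eq_add, ← inner_sharp α β, h0]
  simp

end

end Randers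

end

theorem proposition4 {E : Type*} [NormedAddCommGroup E] [NormedSpace ℝ E] [FiniteDimensional ℝ E]
    {M : Type*} [TopologicalSpace M] [ChartedSpace E M] [IsManifold 𝓘(ℝ, E) ∞ M]
    [T2Space M] [SecondCountableTopology M] [ConnectedSpace M]
    (F : TangentBundle 𝓘(ℝ, E) M → ℝ) (α : Randers.RMetric E M)
    (β : Π p : M, TangentSpace 𝓘(ℝ, E) p →L[ℝ] ℝ)
    (hF : Randers.IsRandersMetric F α β) (hnR : ¬ Randers.IsRiemannian F) :
    Randers.IsGeneralizedBerwald F ↔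
      ∃ K : ℝ, 0 < K ∧ ∀ p : M, Randers.length α p (Randers.sharp α β p) = K := by
  -- With second countability this yields σ-compactness, needed for the partition of unity.
  have : LocallyCompactSpace M := ChartedSpace.locallyCompactSpace E M
  constructor
  · intro hB
    have hconst := Randers.isLocallyConstant_length_sharp hF hB
    obtain ⟨x⟩ : Nonempty M := inferInstance
    have hK := fun p ↦ hconst.apply_eq_of_preconnectedSpace p x
    refine ⟨_, ?_, hK⟩
    -- The constant is positive because length zero would force `β = 0` and `F = √α`.
    refine (Real.sqrt_nonneg _).lt_of_ne fun h0 ↦ hnR ?_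
    exact Randers.isRiemannian_of_length_sharp_eq_zero hF fun p ↦ (hK p).trans h0.symm
  · rintro ⟨K, hK, h⟩
    obtain ⟨cov, hcov, hpar⟩ := Randers.exists_isMetricAndParallel α hF.smooth_form hK h
    exact ⟨cov, hcov, hpar.isCompatible hF⟩
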